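/- Let $n\ge 3$ and let $D=(W_0,\dots,W_n)\in\mathbb{C}^{n+1}$ be non-zero. Put $P_D(Z_0,\dots,Z_n)=W_0Z_0+\cdots+W_nZ_n$, and let $$m(P_D)=\frac{1}{(2\pi)^{n+1}}\int_{[0,2\pi]^{n+1}}\log\bigl|P_D(e^{i\theta_0},\dots,e^{i\theta_n})\bigr|\,d\theta_0\cdots d\theta_n$$ be its logarithmic Mahler measure (the integrand is absolutely integrable). Let $c(D)>0$ be given by $c(D)^2=(n+1)\,(|W_0|^2+\cdots+|W_n|^2)$. For $k\ge 0$ let $$a(n,k,D)=\sum_{\substack{e_0+\cdots+e_n=k\\ e_0,\dots,e_n\ge 0}}\binom{k}{e_0,\dots,e_n}^2|W_0|^{2e_0}\cdots|W_n|^{2e_n},$$ and for an integer $\ell\ge 0$ let $H_\ell=\sum_{i=1}^{\ell}\frac1i$ and $$S_D(\ell)=\sum_{j=1}^{\infty}\frac{2j+\ell}{j(j+\ell)}\sum_{k=0}^{j}\binom{j+\ell+k-1}{k}\binom{j}{k}\frac{(-1)^k\,a(n,k,D)}{c(D)^{2k}}.$$ Then the following hold. 1. The series $S_D(1)$ (as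 a series in $j$) converges absolutely, and $m(P_D)=\log c(D)-\tfrac12 H_1-\tfrac12 S_D(1)$. 2. If $|W_0|,\dots,|W_n|$ are not all equal, then for every integer $\ell\ge 2$ the series $S_D(\ell)$ converges absolutely, and $m(P_D)=\log c(D)-\tfrac12 H_\ell-\tfrac12 S_D(\ell)$. 3. The series $S_D(0)$ converges absolutely, and $m(P_D)=\log c(D)-\tfrac12 S_D(0)$. -/

import Mathlib

open MeasureTheory

noncomputable section

namespace LinearMahler

/-- The function `θ ↦ log |P(e^{iθ₁}, …, e^{iθ_N})|` on the space of angles. -/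
def logAbsOnTorus {N : ℕ} (P : MvPolynomial (Fin N) ℂ) (θ : Fin N → ℝ) : ℝ :=
  Real.log ‖MvPolynomial.eval (fun i => Complex.exp ((θ i : ℂ) * Complex.I)) P‖

/-- The cube `[0, 2π]^N`. -/
def angleCube (N : ℕ) : Set (Fin N → ℝ) :=
  Set.Icc (fun _ => 0) (fun _ => 2 * Real.pi)

/-- The Mahler measure `M(P)` of a polynomial in `N` variables. -/
def mahlerMeasure {N : ℕ} (P : MvPolynomial (Fin N) ℂ) : ℝ :=
  Real.exp (1 / (2 * Real.pi) ^ N * ∫ θ in angleCube N, logAbsOnTorus P θ)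

/-- The logarithmic Mahler measure `m(P) = log M(P)`. -/
def logMahlerMeasure {N : ℕ} (P : MvPolynomial (Fin N) ℂ) : ℝ :=
  Real.log (mahlerMeasure P)

/-- The linear form `P_D(Z₀, …, Z_n) = W₀ Z₀ + ⋯ + W_n Z_n`, where `D = (W₀, …, W_n)`. -/
def linearForm {n : ℕ} (D : Fin (n + 1) → ℂ) : MvPolynomial (Fin (n + 1)) ℂ :=
  ∑ i, MvPolynomial.C (D i) * MvPolynomial.X i

/-- `c(D)`, the positive square root of `(n + 1) ‖D‖² = (n + 1) (|W₀|² + ⋯ + |W_n|²)`. -/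
def c {n : ℕ} (D : Fin (n + 1) → ℂ) : ℝ :=
  Real.sqrt (((n : ℝ) + 1) * ∑ i, ‖D i‖ ^ 2)

/-- `a(n, k, D)`: the sum over all `(e₀, …, e_n)` of natural numbers with `e₀ + ⋯ + e_n = k` of
the squared multinomial coefficient times `|W₀|^{2e₀} ⋯ |W_n|^{2e_n}`. -/
def a {n : ℕ} (k : ℕ) (D : Fin (n + 1) → ℂ) : ℝ :=
  ∑ e ∈ Finset.piAntidiag (Finset.univ : Finset (Fin (n + 1))) k,
    (Nat.multinomial Finset.univ e : ℝ) ^ 2 * ∏ i, ‖D i‖ ^ (2 * e i)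

/-- The `j`-th term of the series `S_D(ℓ)`. It is only used for `j ≥ 1`, where the subtraction
of natural numbers `j + ℓ + k - 1` is not truncated. -/
def term {n : ℕ} (D : Fin (n + 1) → ℂ) (ℓ j : ℕ) : ℝ :=
  (2 * (j : ℝ) + (ℓ : ℝ)) / ((j : ℝ) * ((j : ℝ) + (ℓ : ℝ))) *
    ∑ k ∈ Finset.range (j + 1),
      (Nat.choose (j + ℓ + k - 1) k : ℝ) * (Nat.choose j k : ℝ) *
        ((-1) ^ k * a k D / c D ^ (2 * k))

/-- `S_D(ℓ)`, the sum of the terms with index `1, 2, 3, …`. -/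
def S {n : ℕ} (D : Fin (n + 1) → ℂ) (ℓ : ℕ) : ℝ :=
  ∑' j : ℕ, term D ℓ (j + 1)

end LinearMahler

end

/-! Let X = |P_D|² / c(D)² with independent uniform angles. Orthogonality of characters gives E[X^k]
= a(n,k,D) / c(D)^{2k}, so each term of S_D(ℓ) is a rational coefficient times E[`jacobi ℓ j` (X)],
while m(P_D) = log c(D) + ½ E[log X]. The theorem thus integrates term by term an expansion of -log
in Jacobi polynomials; by Cauchy-Schwarz, X lies almost surely in (0, 1).

For ℓ = 0 the derivative of the remainder telescopes to `jacobi 1 N x / x`, so the remainder is an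
integral over [x, 1]. It is at most -log x, because Legendre polynomials are bounded by 1, and it
tends to 0, because they tend to 0 inside the interval. A contiguity relation passes from ℓ to ℓ +
1: partial sums change by 1/(ℓ+1) and a boundary term that vanishes in the limit, whence the
harmonic numbers.

Absolute convergence comes from Laplace's integral, which bounds ∑ |`jacobi 1 j`(x)| / j by C - log
x - log(1 - x). Here log X is integrable by Jensen's formula and Fubini. So is log(1 - X), since a
sharpened Cauchy-Schwarz inequality gives 1 - X ≥ |W_i z_i - W_j z_j|² / c(D)², again a linear form.
Raising ℓ beyond 1 costs a division by 1 - X, harmless when two moduli differ because then 1 - X is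
bounded below. -/

namespace LinearMahler

/-! ### Jacobi polynomials and their contiguity relations -/

/-- The hypergeometric polynomial `₂F₁(-j, j + ℓ; 1; x)`, that is, the Jacobi polynomial
`P_j^{(0, ℓ - 1)}(1 - 2x)`. -/
noncomputable def jacobi (ℓ j : ℕ) (x : ℝ) : ℝ :=
  ∑ k ∈ Finset.range (j + 1),
    (Nat.choose (j + ℓ + k - 1) k : ℝ) * (Nat.choose j k : ℝ) * ((-1) ^ k * x ^ k)

theorem jacobi_eq_sum_range {ℓ j N : ℕ} (h : j + 1 ≤ N) (x : ℝ) :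
    jacobi ℓ j x = ∑ k ∈ Finset.range N,
      (Nat.choose (j + ℓ + k - 1) k : ℝ) * (Nat.choose j k : ℝ) * ((-1) ^ k * x ^ k) := by
  refine Finset.sum_subset (Finset.range_mono h) fun k _ hk => ?_
  have : j < k := by rw [Finset.mem_range] at hk; omega
  simp [Nat.choose_eq_zero_of_lt this]

@[simp] theorem jacobi_degree_zero (ℓ : ℕ) (x : ℝ) : jacobi ℓ 0 x = 1 := by
  simp [jacobi]

theorem add_one_mul_choose (j k : ℕ) :
    ((j : ℝ) + 1) * (Nat.choose j k : ℝ) = ((j : ℝ) + 1 - k) * (Nat.choose (j + 1) k : ℝ) := by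
  rcases le_or_gt k (j + 1) with h | h
  · have := Nat.choose_mul_succ_eq j k
    have h2 : ((j.choose k * (j + 1) : ℕ) : ℝ) = (((j + 1).choose k * (j + 1 - k) : ℕ) : ℝ) := by
      exact_mod_cast this
    push_cast [Nat.cast_sub h] at h2
    linarith
  · simp [Nat.choose_eq_zero_of_lt h, Nat.choose_eq_zero_of_lt (show j < k by omega)]

theorem add_one_mul_choose_add (N k : ℕ) :
    ((N : ℝ) + 1) * (Nat.choose (N + k + 1) k : ℝ) =
      ((N : ℝ) + 1 + k) * (Nat.choose (N + k) k : ℝ) := by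
  have := add_one_mul_choose (N + k) k
  push_cast at this
  linarith

/-- Contiguity relation lowering the parameter. -/
theorem jacobi_contiguous (ℓ j : ℕ) (x : ℝ) :
    (2 * ((j : ℝ) + 1) + ℓ) * jacobi ℓ (j + 1) x =
      ((j : ℝ) + 1 + ℓ) * jacobi (ℓ + 1) (j + 1) x + ((j : ℝ) + 1) * jacobi (ℓ + 1) j x := by
  rw [jacobi_eq_sum_range (ℓ := ℓ + 1) (show j + 1 ≤ j + 1 + 1 by omega), jacobi, jacobi,
    Finset.mul_sum, Finset.mul_sum, Finset.mul_sum, ← Finset.sum_add_distrib]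
  refine Finset.sum_congr rfl fun k _ => ?_
  have h1 := add_one_mul_choose j k
  have h2 := add_one_mul_choose_add (j + ℓ) k
  push_cast at h2
  rw [show j + 1 + ℓ + k - 1 = j + ℓ + k by omega,
    show j + 1 + (ℓ + 1) + k - 1 = j + ℓ + k + 1 by omega,
    show j + (ℓ + 1) + k - 1 = j + ℓ + k by omega]
  linear_combination (-(Nat.choose (j + ℓ + k) k : ℝ) * ((-1) ^ k * x ^ k)) * h1 -
    ((Nat.choose (j + 1) k : ℝ) * ((-1) ^ k * x ^ k)) * h2

/-- Contiguity relation raising the parameter. -/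
theorem one_sub_mul_jacobi (ℓ j : ℕ) (x : ℝ) :
    (2 * (j : ℝ) + ℓ + 1) * (1 - x) * jacobi (ℓ + 1) j x =
      ((j : ℝ) + 1) * jacobi ℓ (j + 1) x + ((j : ℝ) + ℓ) * jacobi ℓ j x := by
  have hA := jacobi_eq_sum_range (ℓ := ℓ + 1) (show j + 1 ≤ j + 1 + 1 by omega) x
  have hB := jacobi_eq_sum_range (ℓ := ℓ + 1) (le_refl (j + 1)) x
  have hC := jacobi_eq_sum_range (ℓ := ℓ) (le_refl (j + 1 + 1)) x
  have hD := jacobi_eq_sum_range (ℓ := ℓ) (show j + 1 ≤ j + 1 + 1 by omega) x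
  rw [Finset.sum_range_succ' _ (j + 1)] at hA hC hD
  -- This compares the coefficients of `x ^ (m + 1)`; the constant terms have been split off. Every
  -- binomial is a rational multiple of `choose (j + ℓ + m) m` or `choose j m`.
  have key : ∀ m : ℕ,
      (2 * (j : ℝ) + ℓ + 1) * ((Nat.choose (j + (ℓ + 1) + (m + 1) - 1) (m + 1) : ℝ) *
          (Nat.choose j (m + 1) : ℝ) * ((-1) ^ (m + 1) * x ^ (m + 1)) -
        x * ((Nat.choose (j + (ℓ + 1) + m - 1) m : ℝ) * (Nat.choose j m : ℝ) *
          ((-1) ^ m * x ^ m))) =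
      ((j : ℝ) + 1) * ((Nat.choose (j + 1 + ℓ + (m + 1) - 1) (m + 1) : ℝ) *
          (Nat.choose (j + 1) (m + 1) : ℝ) * ((-1) ^ (m + 1) * x ^ (m + 1))) +
        ((j : ℝ) + ℓ) * ((Nat.choose (j + ℓ + (m + 1) - 1) (m + 1) : ℝ) *
          (Nat.choose j (m + 1) : ℝ) * ((-1) ^ (m + 1) * x ^ (m + 1))) := by
    intro m
    rw [show j + (ℓ + 1) + (m + 1) - 1 = j + ℓ + m + 1 by omega,
      show j + (ℓ + 1) + m - 1 = j + ℓ + m by omega,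
      show j + 1 + ℓ + (m + 1) - 1 = j + ℓ + m + 1 by omega,
      show j + ℓ + (m + 1) - 1 = j + ℓ + m by omega]
    have hm : (m : ℝ) + 1 ≠ 0 := by positivity
    have e1 : (Nat.choose (j + ℓ + m + 1) (m + 1) : ℝ) =
        ((j : ℝ) + ℓ + m + 1) / (m + 1) * Nat.choose (j + ℓ + m) m := by
      have := Nat.add_one_mul_choose_eq (j + ℓ + m) m
      have h : (((j + ℓ + m + 1) * (j + ℓ + m).choose m : ℕ) : ℝ) =
        (((j + ℓ + m + 1).choose (m + 1) * (m + 1) : ℕ) : ℝ) := by exact_mod_cast this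
      push_cast at h
      field_simp
      linarith
    have e2 : (Nat.choose (j + 1) (m + 1) : ℝ) =
        ((j : ℝ) + 1) / (m + 1) * Nat.choose j m := by
      have := Nat.add_one_mul_choose_eq j m
      have h : (((j + 1) * j.choose m : ℕ) : ℝ) =
        (((j + 1).choose (m + 1) * (m + 1) : ℕ) : ℝ) := by exact_mod_cast this
      push_cast at h
      field_simp
      linarith
    have e3 : (Nat.choose j (m + 1) : ℝ) = ((j : ℝ) - m) / (m + 1) * Nat.choose j m := by
      have h : (((j + 1).choose (m + 1) : ℕ) : ℝ) = ((j.choose m + j.choose (m + 1) : ℕ) : ℝ) := by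
        rw [Nat.choose_succ_succ]
      push_cast at h
      rw [e2] at h
      field_simp at h ⊢
      linarith
    have e4 : (Nat.choose (j + ℓ + m) (m + 1) : ℝ) =
        ((j : ℝ) + ℓ) / (m + 1) * Nat.choose (j + ℓ + m) m := by
      have h : (((j + ℓ + m + 1).choose (m + 1) : ℕ) : ℝ) =
          (((j + ℓ + m).choose m + (j + ℓ + m).choose (m + 1) : ℕ) : ℝ) := by
        rw [Nat.choose_succ_succ]
      push_cast at h
      rw [e1] at h
      field_simp at h ⊢
      linarith
    rw [e1, e2, e3, e4]
    field_simp
    ring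
  have hsum := Finset.sum_congr (rfl : Finset.range (j + 1) = _) (fun m _ => key m)
  rw [← Finset.mul_sum, Finset.sum_sub_distrib, ← Finset.mul_sum, Finset.sum_add_distrib,
    ← Finset.mul_sum, ← Finset.mul_sum] at hsum
  simp only [Nat.choose_zero_right, pow_zero, Nat.cast_one, mul_one] at hA hC hD
  linear_combination hsum + (2 * (j : ℝ) + ℓ + 1) * (hA - x * hB) - ((j : ℝ) + 1) * hC -
    ((j : ℝ) + ℓ) * hD

theorem jacobi_zero_succ_one (j : ℕ) : jacobi 0 (j + 1) 1 = 0 := by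
  induction j with
  | zero => norm_num [jacobi, Finset.sum_range_succ]
  | succ j ih =>
    have h := one_sub_mul_jacobi 0 (j + 1) 1
    rw [ih] at h
    simp only [sub_self, mul_zero, zero_mul, add_zero] at h
    have hj : (((j + 1 : ℕ) : ℝ) + 1) ≠ 0 := by positivity
    exact (mul_eq_zero.1 h.symm).resolve_left hj

/-- Writing the derivative as a difference of consecutive Legendre polynomials is what makes the
derivative of the logarithmic expansion telescope. -/
theorem hasDerivAt_jacobi_zero (j : ℕ) {x : ℝ} (hx : x ≠ 0) :
    HasDerivAt (jacobi 0 (j + 1))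
      (((j : ℝ) + 1) / 2 * (jacobi 1 (j + 1) x - jacobi 1 j x) / x) x := by
  have h : HasDerivAt (jacobi 0 (j + 1)) (∑ k ∈ Finset.range (j + 1 + 1),
      (Nat.choose (j + 1 + 0 + k - 1) k : ℝ) * (Nat.choose (j + 1) k : ℝ) *
        ((-1) ^ k * (k * x ^ (k - 1)))) x := by
    unfold jacobi
    refine HasDerivAt.fun_sum fun k _ => ?_
    exact ((hasDerivAt_pow k x).const_mul _).const_mul _
  convert h using 1
  rw [div_eq_iff hx, Finset.sum_mul,
    jacobi_eq_sum_range (ℓ := 1) (j := j) (show j + 1 ≤ j + 1 + 1 by omega), jacobi,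
    ← Finset.sum_sub_distrib, Finset.mul_sum]
  refine Finset.sum_congr rfl fun k _ => ?_
  have h1 := add_one_mul_choose j k
  have h2 := add_one_mul_choose_add j k
  rw [show j + 1 + 0 + k - 1 = j + k by omega, show j + 1 + 1 + k - 1 = j + k + 1 by omega]
  have h3 : (k : ℝ) * x ^ (k - 1) * x = k * x ^ k := by
    cases k with
    | zero => simp
    | succ k => simp [pow_succ, mul_assoc]
  linear_combination (-(Nat.choose (j + k) k : ℝ) * ((-1) ^ k * x ^ k) / 2) * h1 +
    ((Nat.choose (j + 1) k : ℝ) * ((-1) ^ k * x ^ k) / 2) * h2 -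
    ((Nat.choose (j + k) k : ℝ) * (Nat.choose (j + 1) k : ℝ) * (-1) ^ k) * h3

/-! ### Laplace's integral and bounds for Legendre polynomials -/

/-- The expansion of the Legendre polynomial at `1 - 2x` in powers of `x` and `1 - x`. -/
theorem jacobi_one_eq_sum_sq (j : ℕ) (x : ℝ) :
    jacobi 1 j x = ∑ k ∈ Finset.range (j + 1),
      (Nat.choose j k : ℝ) ^ 2 * ((-1) ^ k * x ^ k * (1 - x) ^ (j - k)) := by
  have h : ∀ k ∈ Finset.range (j + 1),
      (Nat.choose j k : ℝ) ^ 2 * ((-1) ^ k * x ^ k * (1 - x) ^ (j - k)) =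
        ∑ m ∈ Finset.Ico k (j + 1), ((j.choose m * (m.choose k * j.choose k) : ℕ) : ℝ) *
          ((-1) ^ m * x ^ m) := by
    intro k hk
    have hk : k ≤ j := by simpa [Nat.lt_succ_iff] using hk
    rw [Finset.sum_Ico_eq_sum_range, sub_eq_neg_add, add_pow,
      show j + 1 - k = j - k + 1 by omega, Finset.mul_sum, Finset.mul_sum]
    refine Finset.sum_congr rfl fun i hi => ?_
    have hi : i ≤ j - k := by simpa [Nat.lt_succ_iff] using hi
    have hc := Nat.choose_mul (n := j) (k := k + i) (s := k) (by omega)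
    rw [← mul_assoc (j.choose (k + i)), hc, show k + i - k = i by omega, neg_pow]
    push_cast
    ring
  rw [Finset.sum_congr rfl h, Finset.sum_comm' (t' := Finset.range (j + 1))
    (s' := fun m => Finset.range (m + 1)) (by intro a b; simp; omega), jacobi]
  refine Finset.sum_congr rfl fun m _ => ?_
  -- Vandermonde's identity: the sum over k of C(m,k) C(j,k) is C(j+m,m).
  rw [← Finset.sum_mul, ← Nat.cast_sum, ← Finset.mul_sum, show j + 1 + m - 1 = j + m by omega,
    Nat.add_choose_eq, Finset.Nat.sum_antidiagonal_eq_sum_range_succ_mk]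
  push_cast
  rw [mul_comm (∑ _ ∈ _, _)]
  congr 2
  refine Finset.sum_congr rfl fun k hk => ?_
  have hk : k ≤ m := by simpa [Nat.lt_succ_iff] using hk
  rw [Nat.choose_symm hk, mul_comm]

theorem integral_exp_pow_mul_exp_neg_pow (k m : ℕ) :
    ∫ s in (0 : ℝ)..2 * Real.pi,
      Complex.exp (s * Complex.I) ^ k * Complex.exp (-(s * Complex.I)) ^ m =
        if k = m then ((2 * Real.pi : ℝ) : ℂ) else 0 := by
  have h : ∀ s : ℝ, Complex.exp (s * Complex.I) ^ k * Complex.exp (-(s * Complex.I)) ^ m =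
      Complex.exp ((((k : ℂ) - m) * Complex.I) * s) := by
    intro s
    rw [← Complex.exp_nat_mul, ← Complex.exp_nat_mul, ← Complex.exp_add]
    congr 1
    ring
  simp_rw [h]
  split_ifs with hkm
  · simp [hkm]
  · have hc : ((k : ℂ) - m) * Complex.I ≠ 0 :=
      mul_ne_zero (sub_ne_zero.2 (by exact_mod_cast hkm)) Complex.I_ne_zero
    rw [integral_exp_mul_complex hc, div_eq_zero_iff]
    left
    rw [show ((k : ℂ) - m) * Complex.I * ((2 * Real.pi : ℝ) : ℂ) =
      ((k - m : ℤ) : ℂ) * (2 * Real.pi * Complex.I) by push_cast; ring,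
      Complex.exp_int_mul_two_pi_mul_I]
    simp

/-- Both factors are expanded by the binomial theorem; integration keeps only the diagonal terms. -/
theorem integral_mul_pow_eq_sum_choose_sq (u w : ℂ) (j : ℕ) :
    ∫ s in (0 : ℝ)..2 * Real.pi,
      ((u + w * Complex.exp (s * Complex.I)) * (u + w * Complex.exp (-(s * Complex.I)))) ^ j =
      2 * Real.pi * ∑ k ∈ Finset.range (j + 1),
        (Nat.choose j k : ℂ) ^ 2 * ((w ^ 2) ^ k * (u ^ 2) ^ (j - k)) := by
  have h : ∀ s : ℝ,
      ((u + w * Complex.exp (s * Complex.I)) * (u + w * Complex.exp (-(s * Complex.I)))) ^ j =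
      ∑ k ∈ Finset.range (j + 1), ∑ m ∈ Finset.range (j + 1),
        (w ^ k * u ^ (j - k) * Nat.choose j k * (w ^ m * u ^ (j - m) * Nat.choose j m)) *
          (Complex.exp (s * Complex.I) ^ k * Complex.exp (-(s * Complex.I)) ^ m) := by
    intro s
    rw [mul_pow, add_comm u, add_comm u, add_pow, add_pow, Finset.sum_mul_sum]
    refine Finset.sum_congr rfl fun k _ => Finset.sum_congr rfl fun m _ => ?_
    ring
  simp_rw [h]
  rw [intervalIntegral.integral_finsetSum
    (fun k _ => Continuous.intervalIntegrable (by fun_prop) _ _), Finset.mul_sum]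
  refine Finset.sum_congr rfl fun k hk => ?_
  rw [intervalIntegral.integral_finsetSum
    (fun k _ => Continuous.intervalIntegrable (by fun_prop) _ _)]
  simp_rw [intervalIntegral.integral_const_mul, integral_exp_pow_mul_exp_neg_pow]
  simp only [mul_ite, mul_zero]
  rw [Finset.sum_ite_eq, if_pos hk]
  push_cast
  ring

/-- The modulus of the integrand in Laplace's integral for Legendre polynomials. -/
noncomputable def laplaceModulus (x s : ℝ) : ℝ :=
  Real.sqrt (1 - 4 * x * (1 - x) * Real.sin s ^ 2)

theorem continuous_laplaceModulus (x : ℝ) : Continuous (laplaceModulus x) := by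
  unfold laplaceModulus
  fun_prop

theorem laplaceModulus_nonneg (x s : ℝ) : 0 ≤ laplaceModulus x s := Real.sqrt_nonneg _

theorem laplaceModulus_le_one {x : ℝ} (h0 : 0 ≤ x) (h1 : x ≤ 1) (s : ℝ) :
    laplaceModulus x s ≤ 1 := by
  rw [laplaceModulus, Real.sqrt_le_iff]
  refine ⟨zero_le_one, ?_⟩
  have : 0 ≤ 4 * x * (1 - x) * Real.sin s ^ 2 := by
    have := sub_nonneg.2 h1
    positivity
  linarith

/-- The consequence of Laplace's integral for Legendre polynomials. -/
theorem abs_jacobi_one_le_integral {x : ℝ} (h0 : 0 ≤ x) (h1 : x ≤ 1) (j : ℕ) :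
    |jacobi 1 j x| ≤ (2 * Real.pi)⁻¹ * ∫ s in (0 : ℝ)..2 * Real.pi, laplaceModulus x s ^ j := by
  have hpi : 0 < 2 * Real.pi := Real.two_pi_pos
  set u : ℝ := Real.sqrt (1 - x)
  set v : ℝ := Real.sqrt x
  have hu : u ^ 2 = 1 - x := Real.sq_sqrt (sub_nonneg.2 h1)
  have hv : v ^ 2 = x := Real.sq_sqrt h0
  -- With u² = 1 - x and w = i√x, so that w² = -x, the sum of squared binomials is the Legendre
  -- polynomial at 1 - 2x.
  have key := integral_mul_pow_eq_sum_choose_sq (u : ℂ) (Complex.I * v) j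
  have hs : (∑ k ∈ Finset.range (j + 1), (Nat.choose j k : ℂ) ^ 2 *
      (((Complex.I * v) ^ 2) ^ k * ((u : ℂ) ^ 2) ^ (j - k))) = ((jacobi 1 j x : ℝ) : ℂ) := by
    rw [jacobi_one_eq_sum_sq]
    push_cast
    refine Finset.sum_congr rfl fun k _ => ?_
    have hu' : (u : ℂ) ^ 2 = 1 - x := by exact_mod_cast congrArg Complex.ofReal hu
    have hv' : (v : ℂ) ^ 2 = x := by exact_mod_cast congrArg Complex.ofReal hv
    rw [mul_pow, Complex.I_sq, hu', hv', mul_pow]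
  rw [hs] at key
  have hnorm : ∀ s : ℝ, ‖((u + Complex.I * v * Complex.exp (s * Complex.I)) *
      (u + Complex.I * v * Complex.exp (-(s * Complex.I)))) ^ j‖ = laplaceModulus x s ^ j := by
    intro s
    rw [norm_pow]
    congr 1
    have e : (u + Complex.I * v * Complex.exp (s * Complex.I)) *
      (u + Complex.I * v * Complex.exp (-(s * Complex.I))) =
        ((1 - 2 * x : ℝ) : ℂ) + ((2 * u * v * Real.cos s : ℝ) : ℂ) * Complex.I := by
      have h2 : Complex.exp (s * Complex.I) * Complex.exp (-(s * Complex.I)) = 1 := by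
        rw [← Complex.exp_add]; simp
      have h3 : Complex.exp (s * Complex.I) + Complex.exp (-(s * Complex.I)) =
          2 * Complex.cos s := by
        rw [Complex.cos]; ring_nf
      have hu' : (u : ℂ) ^ 2 = 1 - x := by exact_mod_cast congrArg Complex.ofReal hu
      have hv' : (v : ℂ) ^ 2 = x := by exact_mod_cast congrArg Complex.ofReal hv
      push_cast
      linear_combination (Complex.I * v) ^ 2 * h2 + u * v * Complex.I * h3 + hu' - hv' +
        v ^ 2 * Complex.I_sq
    rw [e, Complex.norm_add_mul_I, laplaceModulus]
    congr 1
    have : Real.sin s ^ 2 = 1 - Real.cos s ^ 2 := Real.sin_sq s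
    rw [this, mul_pow, mul_pow, mul_pow, hu, hv]
    ring
  have hle := intervalIntegral.norm_integral_le_integral_norm (μ := volume)
    (f := fun s : ℝ => ((u + Complex.I * v * Complex.exp (s * Complex.I)) *
      (u + Complex.I * v * Complex.exp (-(s * Complex.I)))) ^ j) hpi.le
  rw [key] at hle
  simp_rw [hnorm] at hle
  rw [norm_mul, Complex.norm_real, Real.norm_eq_abs] at hle
  have h2 : ‖(2 * Real.pi : ℂ)‖ = 2 * Real.pi := by
    rw [show (2 * Real.pi : ℂ) = ((2 * Real.pi : ℝ) : ℂ) by push_cast; rfl, Complex.norm_real,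
      Real.norm_of_nonneg hpi.le]
  rw [h2] at hle
  rw [inv_mul_eq_div, le_div_iff₀ hpi]
  linarith

theorem abs_jacobi_one_le_one {x : ℝ} (h0 : 0 ≤ x) (h1 : x ≤ 1) (j : ℕ) :
    |jacobi 1 j x| ≤ 1 := by
  refine (abs_jacobi_one_le_integral h0 h1 j).trans ?_
  have hpi : 0 < 2 * Real.pi := Real.two_pi_pos
  have h : ∫ s in (0 : ℝ)..2 * Real.pi, laplaceModulus x s ^ j ≤
      ∫ _ in (0 : ℝ)..2 * Real.pi, (1 : ℝ) :=
    intervalIntegral.integral_mono_on hpi.le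
      (((continuous_laplaceModulus x).pow j).intervalIntegrable _ _)
      intervalIntegrable_const
      fun s _ => pow_le_one₀ (laplaceModulus_nonneg x s) (laplaceModulus_le_one h0 h1 s)
  rw [intervalIntegral.integral_const, sub_zero, smul_eq_mul, mul_one] at h
  rw [inv_mul_eq_div, div_le_one hpi]
  exact h

theorem ae_sin_ne_zero : ∀ᵐ s : ℝ, Real.sin s ≠ 0 := by
  have hc : (Set.range fun n : ℤ => (n : ℝ) * Real.pi).Countable := Set.countable_range _
  filter_upwards [hc.ae_notMem volume] with s hs h
  exact hs (Real.sin_eq_zero_iff.1 h)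

theorem laplaceModulus_lt_one {x s : ℝ} (h0 : 0 < x) (h1 : x < 1) (hs : Real.sin s ≠ 0) :
    laplaceModulus x s < 1 := by
  rw [laplaceModulus, Real.sqrt_lt' one_pos]
  have : 0 < 4 * x * (1 - x) * Real.sin s ^ 2 := by
    have := sub_pos.2 h1
    positivity
  linarith

theorem tendsto_jacobi_one {x : ℝ} (h0 : 0 < x) (h1 : x < 1) :
    Filter.Tendsto (fun j => jacobi 1 j x) Filter.atTop (nhds 0) := by
  have h : Filter.Tendsto
      (fun j : ℕ => (2 * Real.pi)⁻¹ * ∫ s in (0 : ℝ)..2 * Real.pi, laplaceModulus x s ^ j)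
      Filter.atTop (nhds ((2 * Real.pi)⁻¹ * ∫ _ in (0 : ℝ)..2 * Real.pi, (0 : ℝ))) := by
    refine Filter.Tendsto.const_mul _ ?_
    refine intervalIntegral.tendsto_integral_filter_of_dominated_convergence (fun _ => 1)
      ?_ ?_ intervalIntegrable_const ?_
    · exact Filter.Eventually.of_forall fun j =>
        ((continuous_laplaceModulus x).pow j).aestronglyMeasurable
    · refine Filter.Eventually.of_forall fun j => Filter.Eventually.of_forall fun s _ => ?_
      rw [Real.norm_of_nonneg (pow_nonneg (laplaceModulus_nonneg x s) j)]
      exact pow_le_one₀ (laplaceModulus_nonneg x s) (laplaceModulus_le_one h0.le h1.le s)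
    · filter_upwards [ae_sin_ne_zero] with s hs _
      exact tendsto_pow_atTop_nhds_zero_of_lt_one (laplaceModulus_nonneg x s)
        (laplaceModulus_lt_one h0 h1 hs)
  simp only [intervalIntegral.integral_zero, mul_zero] at h
  exact squeeze_zero_norm (fun j => abs_jacobi_one_le_integral h0.le h1.le j) h

/-- The sum is a partial sum of the series of -log(1 - q), where q is the modulus. Since 1 - q ≥ (1
- q²)/2 = 2x(1 - x) sin² s, the logarithm separates x from s. As `Real.log` is even, `Real.log
(Real.sin s)` means log |sin s|. -/
theorem sum_laplaceModulus_pow_div_le {x s : ℝ} (h0 : 0 < x) (h1 : x < 1)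
    (hs : Real.sin s ≠ 0) (N : ℕ) :
    ∑ j ∈ Finset.range N, laplaceModulus x s ^ (j + 1) / ((j : ℝ) + 1) ≤
      -Real.log 2 - Real.log x - Real.log (1 - x) - 2 * Real.log (Real.sin s) := by
  have hq0 := laplaceModulus_nonneg x s
  have hq1 := laplaceModulus_lt_one h0 h1 hs
  have hsum := Real.hasSum_pow_div_log_of_abs_lt_one (x := laplaceModulus x s)
    (by rwa [abs_of_nonneg hq0])
  have h1x : 0 < 1 - x := sub_pos.2 h1
  have hle : 2 * x * (1 - x) * Real.sin s ^ 2 ≤ 1 - laplaceModulus x s := by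
    have hsq : laplaceModulus x s ^ 2 = 1 - 4 * x * (1 - x) * Real.sin s ^ 2 := by
      refine Real.sq_sqrt ?_
      have h4 : 4 * x * (1 - x) ≤ 1 := by nlinarith [sq_nonneg (2 * x - 1)]
      have h5 : Real.sin s ^ 2 ≤ 1 := Real.sin_sq_le_one s
      nlinarith [mul_pos h0 h1x, sq_nonneg (Real.sin s)]
    nlinarith
  have hpos : 0 < 2 * x * (1 - x) * Real.sin s ^ 2 := by positivity
  calc _ ≤ -Real.log (1 - laplaceModulus x s) :=
        sum_le_hasSum _ (fun j _ => by positivity) hsum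
    _ ≤ -Real.log (2 * x * (1 - x) * Real.sin s ^ 2) :=
        neg_le_neg (Real.log_le_log hpos hle)
    _ = _ := by
        rw [Real.log_mul (by positivity) (by positivity), Real.log_mul (by positivity)
          (by positivity), Real.log_mul (by positivity) (by positivity), Real.log_pow]
        push_cast
        ring

/-- The Legendre polynomials are summable against `1 / j`, with a logarithmic bound. -/
theorem exists_sum_abs_jacobi_one_div_le : ∃ C : ℝ, ∀ x : ℝ, 0 < x → x < 1 → ∀ N : ℕ,
    ∑ j ∈ Finset.range N, |jacobi 1 (j + 1) x| / ((j : ℝ) + 1) ≤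
      C - Real.log x - Real.log (1 - x) := by
  have hpi : 0 < 2 * Real.pi := Real.two_pi_pos
  refine ⟨(2 * Real.pi)⁻¹ * (∫ s in (0 : ℝ)..2 * Real.pi,
    (-Real.log 2 - 2 * Real.log (Real.sin s))), fun x h0 h1 N => ?_⟩
  have hInt : IntervalIntegrable (fun s => -Real.log 2 - 2 * Real.log (Real.sin s)) volume
      0 (2 * Real.pi) :=
    intervalIntegrable_const.sub (intervalIntegrable_log_sin.const_mul 2)
  have hcont := continuous_laplaceModulus x
  have hInt' : ∀ j : ℕ, IntervalIntegrable
      (fun s => laplaceModulus x s ^ (j + 1) / ((j : ℝ) + 1)) volume 0 (2 * Real.pi) :=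
    fun j => Continuous.intervalIntegrable (by fun_prop) _ _
  calc _ ≤ ∑ j ∈ Finset.range N, (2 * Real.pi)⁻¹ *
        ∫ s in (0 : ℝ)..2 * Real.pi, laplaceModulus x s ^ (j + 1) / ((j : ℝ) + 1) := by
        refine Finset.sum_le_sum fun j _ => ?_
        rw [intervalIntegral.integral_div, ← mul_div_assoc]
        exact div_le_div_of_nonneg_right (abs_jacobi_one_le_integral h0.le h1.le _) (by positivity)
    _ = (2 * Real.pi)⁻¹ * ∫ s in (0 : ℝ)..2 * Real.pi,
        ∑ j ∈ Finset.range N, laplaceModulus x s ^ (j + 1) / ((j : ℝ) + 1) := by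
        rw [← Finset.mul_sum, intervalIntegral.integral_finsetSum fun j _ => hInt' j]
    _ ≤ (2 * Real.pi)⁻¹ * ∫ s in (0 : ℝ)..2 * Real.pi,
        ((-Real.log 2 - 2 * Real.log (Real.sin s)) + (-Real.log x - Real.log (1 - x))) := by
        refine mul_le_mul_of_nonneg_left ?_ (by positivity)
        refine intervalIntegral.integral_mono_ae hpi.le
          (Continuous.intervalIntegrable (by fun_prop) _ _)
          (hInt.add intervalIntegrable_const) ?_
        filter_upwards [ae_sin_ne_zero] with s hs
        have := sum_laplaceModulus_pow_div_le h0 h1 hs N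
        linarith
    _ = _ := by
        rw [intervalIntegral.integral_add hInt intervalIntegrable_const,
          intervalIntegral.integral_const, smul_eq_mul, mul_add, sub_zero, ← mul_assoc,
          inv_mul_cancel₀ hpi.ne']
        ring

/-! ### Pointwise expansion of the logarithm -/

/-- The remainder of the expansion of `-log` in the polynomials with parameter `0`. -/
noncomputable def logRemainder (N : ℕ) (x : ℝ) : ℝ :=
  Real.log x + ∑ j ∈ Finset.range N, 2 / ((j : ℝ) + 1) * jacobi 0 (j + 1) x

theorem hasDerivAt_logRemainder (N : ℕ) {x : ℝ} (hx : 0 < x) :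
    HasDerivAt (logRemainder N) (jacobi 1 N x / x) x := by
  have h : HasDerivAt (logRemainder N) (x⁻¹ + ∑ j ∈ Finset.range N, 2 / ((j : ℝ) + 1) *
      (((j : ℝ) + 1) / 2 * (jacobi 1 (j + 1) x - jacobi 1 j x) / x)) x :=
    (Real.hasDerivAt_log hx.ne').add (HasDerivAt.fun_sum fun j _ =>
      (hasDerivAt_jacobi_zero j hx.ne').const_mul _)
  convert h using 1
  have hj : ∀ j : ℕ, 2 / ((j : ℝ) + 1) *
      (((j : ℝ) + 1) / 2 * (jacobi 1 (j + 1) x - jacobi 1 j x) / x) =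
      (jacobi 1 (j + 1) x - jacobi 1 j x) / x := by
    intro j
    have : (j : ℝ) + 1 ≠ 0 := by positivity
    field_simp
  simp_rw [hj]
  rw [← Finset.sum_div, Finset.sum_range_sub (fun j => jacobi 1 j x), jacobi_degree_zero]
  ring

theorem continuous_jacobi (ℓ j : ℕ) : Continuous (jacobi ℓ j) := by
  unfold jacobi
  fun_prop

/-- The remainder vanishes at 1, where log and all `jacobi 0 (j + 1)` do. -/
theorem logRemainder_eq_integral (N : ℕ) {x : ℝ} (h0 : 0 < x) (h1 : x ≤ 1) :
    logRemainder N x = -∫ y in x..1, jacobi 1 N y / y := by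
  have hpos : ∀ y ∈ Set.uIcc x 1, 0 < y := fun y hy => by
    rw [Set.uIcc_of_le h1] at hy
    exact h0.trans_le hy.1
  rw [intervalIntegral.integral_eq_sub_of_hasDerivAt
    (fun y hy => hasDerivAt_logRemainder N (hpos y hy))
    (ContinuousOn.intervalIntegrable ((continuous_jacobi 1 N).continuousOn.div continuousOn_id
      fun y hy => (hpos y hy).ne'))]
  simp [logRemainder, jacobi_zero_succ_one]

theorem norm_jacobi_one_div_le {x y : ℝ} (h0 : 0 < x) (h1 : x ≤ 1) (hy : y ∈ Set.uIoc x 1)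
    (N : ℕ) : ‖jacobi 1 N y / y‖ ≤ y⁻¹ := by
  rw [Set.uIoc_of_le h1] at hy
  have hy0 : 0 < y := h0.trans hy.1
  rw [norm_div, Real.norm_eq_abs, Real.norm_of_nonneg hy0.le, div_eq_mul_inv]
  exact mul_le_of_le_one_left (inv_nonneg.2 hy0.le) (abs_jacobi_one_le_one hy0.le hy.2 N)

theorem intervalIntegrable_inv_of_pos {x : ℝ} (h0 : 0 < x) (h1 : x ≤ 1) :
    IntervalIntegrable (fun y : ℝ => y⁻¹) volume x 1 := by
  refine ContinuousOn.intervalIntegrable (continuousOn_id.inv₀ fun y hy => ?_)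
  rw [Set.uIcc_of_le h1] at hy
  exact (h0.trans_le hy.1).ne'

theorem abs_logRemainder_le (N : ℕ) {x : ℝ} (h0 : 0 < x) (h1 : x ≤ 1) :
    |logRemainder N x| ≤ -Real.log x := by
  rw [logRemainder_eq_integral N h0 h1, abs_neg, ← Real.norm_eq_abs]
  refine (intervalIntegral.norm_integral_le_of_norm_le h1 ?_
    (intervalIntegrable_inv_of_pos h0 h1)).trans ?_
  · refine Filter.Eventually.of_forall fun y hy => ?_
    exact norm_jacobi_one_div_le h0 h1 (by rwa [Set.uIoc_of_le h1]) N
  · rw [integral_inv_of_pos h0 one_pos, one_div, Real.log_inv]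

theorem tendsto_logRemainder {x : ℝ} (h0 : 0 < x) (h1 : x ≤ 1) :
    Filter.Tendsto (fun N => logRemainder N x) Filter.atTop (nhds 0) := by
  have h : Filter.Tendsto (fun N : ℕ => -∫ y in x..1, jacobi 1 N y / y) Filter.atTop
      (nhds (-∫ _ in x..1, (0 : ℝ))) := by
    refine Filter.Tendsto.neg ?_
    refine intervalIntegral.tendsto_integral_filter_of_dominated_convergence (fun y => y⁻¹)
      ?_ ?_ (intervalIntegrable_inv_of_pos h0 h1) ?_
    · refine Filter.Eventually.of_forall fun N => ?_
      exact ((continuous_jacobi 1 N).measurable.div measurable_id).aestronglyMeasurable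
    · exact Filter.Eventually.of_forall fun N => Filter.Eventually.of_forall fun y hy =>
        norm_jacobi_one_div_le h0 h1 hy N
    · filter_upwards [(Set.countable_singleton (1 : ℝ)).ae_notMem volume] with y hy1 hy
      rw [Set.uIoc_of_le h1] at hy
      simpa using (tendsto_jacobi_one (h0.trans hy.1) (lt_of_le_of_ne hy.2 hy1)).div_const y
  simp only [intervalIntegral.integral_zero, neg_zero] at h
  exact h.congr fun N => (logRemainder_eq_integral N h0 h1).symm

/-! ### Termwise integration for a random variable in (0, 1) -/

section Expectation

variable {Ω : Type*} [MeasurableSpace Ω]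

/-- The integral of the polynomial `jacobi ℓ j` of a random variable. -/
noncomputable def jacobiMean (μ : Measure Ω) (X : Ω → ℝ) (ℓ j : ℕ) : ℝ :=
  ∫ ω, jacobi ℓ j (X ω) ∂μ

/-- The terms of the expansion of `-∫ log X`, indexed from `0`. -/
noncomputable def logTerm (μ : Measure Ω) (X : Ω → ℝ) (ℓ j : ℕ) : ℝ :=
  (2 * ((j : ℝ) + 1) + ℓ) / (((j : ℝ) + 1) * ((j : ℝ) + 1 + ℓ)) * jacobiMean μ X ℓ (j + 1)

/-- The series `∑ |jacobi ℓ j X| / j` has partial sums dominated by an integrable function. -/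
def LogDominated (μ : Measure Ω) (X : Ω → ℝ) (ℓ : ℕ) : Prop :=
  ∃ w : Ω → ℝ, Integrable w μ ∧ ∀ᵐ ω ∂μ, ∀ N : ℕ,
    ∑ j ∈ Finset.range N, |jacobi ℓ (j + 1) (X ω)| / ((j : ℝ) + 1) ≤ w ω

variable {μ : Measure Ω} {X : Ω → ℝ}

theorem integrable_pow_of_mem_Ioo [IsFiniteMeasure μ] (hX : AEMeasurable X μ)
    (h01 : ∀ᵐ ω ∂μ, X ω ∈ Set.Ioo (0 : ℝ) 1) (k : ℕ) : Integrable (fun ω => X ω ^ k) μ := by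
  refine Integrable.of_bound (hX.pow_const k).aestronglyMeasurable 1 ?_
  filter_upwards [h01] with ω hω
  rw [norm_pow, Real.norm_of_nonneg hω.1.le]
  exact pow_le_one₀ hω.1.le hω.2.le

theorem integrable_jacobi [IsFiniteMeasure μ] (hX : AEMeasurable X μ)
    (h01 : ∀ᵐ ω ∂μ, X ω ∈ Set.Ioo (0 : ℝ) 1) (ℓ j : ℕ) :
    Integrable (fun ω => jacobi ℓ j (X ω)) μ := by
  unfold jacobi
  exact integrable_finsetSum _ fun k _ =>
    ((integrable_pow_of_mem_Ioo hX h01 k).const_mul _).const_mul _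

theorem jacobiMean_eq_sum [IsFiniteMeasure μ] (hX : AEMeasurable X μ)
    (h01 : ∀ᵐ ω ∂μ, X ω ∈ Set.Ioo (0 : ℝ) 1) (ℓ j : ℕ) :
    jacobiMean μ X ℓ j = ∑ k ∈ Finset.range (j + 1),
      (Nat.choose (j + ℓ + k - 1) k : ℝ) * (Nat.choose j k : ℝ) *
        ((-1) ^ k * ∫ ω, X ω ^ k ∂μ) := by
  unfold jacobiMean jacobi
  rw [integral_finsetSum _ fun k _ =>
    ((integrable_pow_of_mem_Ioo hX h01 k).const_mul _).const_mul _]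
  simp_rw [integral_const_mul]

theorem jacobiMean_contiguous [IsFiniteMeasure μ] (hX : AEMeasurable X μ)
    (h01 : ∀ᵐ ω ∂μ, X ω ∈ Set.Ioo (0 : ℝ) 1) (ℓ j : ℕ) :
    (2 * ((j : ℝ) + 1) + ℓ) * jacobiMean μ X ℓ (j + 1) =
      ((j : ℝ) + 1 + ℓ) * jacobiMean μ X (ℓ + 1) (j + 1) +
        ((j : ℝ) + 1) * jacobiMean μ X (ℓ + 1) j := by
  unfold jacobiMean
  rw [← integral_const_mul, ← integral_const_mul, ← integral_const_mul, ← integral_add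
    ((integrable_jacobi hX h01 _ _).const_mul _) ((integrable_jacobi hX h01 _ _).const_mul _)]
  simp_rw [jacobi_contiguous]

theorem LogDominated.summable_jacobiMean [IsFiniteMeasure μ] (hX : AEMeasurable X μ)
    (h01 : ∀ᵐ ω ∂μ, X ω ∈ Set.Ioo (0 : ℝ) 1) {ℓ : ℕ} (h : LogDominated μ X ℓ) :
    Summable fun j : ℕ => |jacobiMean μ X ℓ (j + 1)| / ((j : ℝ) + 1) := by
  obtain ⟨w, hw, hle⟩ := h
  refine summable_of_sum_range_le (c := ∫ ω, w ω ∂μ) (fun j => by positivity) fun N => ?_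
  have hInt : ∀ j : ℕ, Integrable (fun ω => |jacobi ℓ (j + 1) (X ω)| / ((j : ℝ) + 1)) μ :=
    fun j => (integrable_jacobi hX h01 ℓ (j + 1)).abs.div_const _
  calc _ ≤ ∑ j ∈ Finset.range N, ∫ ω, |jacobi ℓ (j + 1) (X ω)| / ((j : ℝ) + 1) ∂μ := by
        refine Finset.sum_le_sum fun j _ => ?_
        rw [integral_div]
        exact div_le_div_of_nonneg_right abs_integral_le_integral_abs (by positivity)
    _ = ∫ ω, ∑ j ∈ Finset.range N, |jacobi ℓ (j + 1) (X ω)| / ((j : ℝ) + 1) ∂μ :=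
        (integral_finsetSum _ fun j _ => hInt j).symm
    _ ≤ ∫ ω, w ω ∂μ := by
        refine integral_mono_ae (integrable_finsetSum _ fun j _ => hInt j) hw ?_
        filter_upwards [hle] with ω hω using hω N

theorem LogDominated.summable_logTerm [IsFiniteMeasure μ] (hX : AEMeasurable X μ)
    (h01 : ∀ᵐ ω ∂μ, X ω ∈ Set.Ioo (0 : ℝ) 1) {ℓ : ℕ} (h : LogDominated μ X ℓ) :
    Summable (logTerm μ X ℓ) := by
  refine Summable.of_norm_bounded ((h.summable_jacobiMean hX h01).mul_left 2) fun j => ?_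
  have hj : (0 : ℝ) < (j : ℝ) + 1 := by positivity
  have hl : (0 : ℝ) ≤ ℓ := by positivity
  rw [logTerm, norm_mul, Real.norm_of_nonneg (by positivity), Real.norm_eq_abs, mul_div_left_comm,
    mul_comm]
  refine mul_le_mul_of_nonneg_left ?_ (abs_nonneg _)
  -- The coefficient of the term is at most 2 / (j + 1).
  rw [div_le_div_iff₀ (by positivity) hj]
  nlinarith [mul_nonneg hj.le hl]

theorem logDominated_one [IsFiniteMeasure μ]
    (h01 : ∀ᵐ ω ∂μ, X ω ∈ Set.Ioo (0 : ℝ) 1)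
    (hlog : Integrable (fun ω => Real.log (X ω)) μ)
    (hlog1 : Integrable (fun ω => Real.log (1 - X ω)) μ) : LogDominated μ X 1 := by
  obtain ⟨C, hC⟩ := exists_sum_abs_jacobi_one_div_le
  refine ⟨fun ω => C - Real.log (X ω) - Real.log (1 - X ω),
    ((integrable_const C).sub hlog).sub hlog1, ?_⟩
  filter_upwards [h01] with ω hω N using hC _ hω.1 hω.2 N

/-- At parameter 0 the contiguity relation says that `jacobi 0 (j + 1)` is the mean of `jacobi 1 (j
+ 1)` and `jacobi 1 j`. The index shift adds only the degree-0 term, equal to 1. -/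
theorem LogDominated.zero [IsFiniteMeasure μ] (h : LogDominated μ X 1) : LogDominated μ X 0 := by
  obtain ⟨w, hw, hle⟩ := h
  refine ⟨fun ω => w ω + 1, hw.add (integrable_const 1), ?_⟩
  filter_upwards [hle] with ω hω N
  have h1 : ∀ j : ℕ, |jacobi 0 (j + 1) (X ω)| / ((j : ℝ) + 1) ≤
      1 / 2 * (|jacobi 1 (j + 1) (X ω)| / ((j : ℝ) + 1)) +
        1 / 2 * (|jacobi 1 j (X ω)| / ((j : ℝ) + 1)) := by
    intro j
    have hj : (0 : ℝ) < (j : ℝ) + 1 := by positivity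
    have e := jacobi_contiguous 0 j (X ω)
    have e2 : jacobi 0 (j + 1) (X ω) = (jacobi 1 (j + 1) (X ω) + jacobi 1 j (X ω)) / 2 := by
      push_cast at e
      have : ((j : ℝ) + 1) * (2 * jacobi 0 (j + 1) (X ω)) =
          ((j : ℝ) + 1) * (jacobi 1 (j + 1) (X ω) + jacobi 1 j (X ω)) := by linarith
      have := mul_left_cancel₀ hj.ne' this
      linarith
    rw [e2, ← mul_div_assoc, ← mul_div_assoc, ← add_div, abs_div, abs_two]
    refine div_le_div_of_nonneg_right ?_ hj.le
    linarith [abs_add_le (jacobi 1 (j + 1) (X ω)) (jacobi 1 j (X ω))]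
  have h2 : ∑ j ∈ Finset.range N, |jacobi 1 j (X ω)| / ((j : ℝ) + 1) ≤ w ω + 1 := by
    cases N with
    | zero =>
      have := hω 0
      simp only [Finset.range_zero, Finset.sum_empty] at this ⊢
      linarith
    | succ N =>
      rw [Finset.sum_range_succ']
      simp only [jacobi_degree_zero, abs_one, Nat.cast_zero, zero_add, div_one]
      refine add_le_add_left (le_trans (Finset.sum_le_sum fun j _ => ?_) (hω N)) 1
      push_cast
      exact div_le_div_of_nonneg_left (abs_nonneg _) (by positivity) (by linarith)
  have h3 := Finset.sum_le_sum fun j (_ : j ∈ Finset.range N) => h1 j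
  rw [Finset.sum_add_distrib, ← Finset.mul_sum, ← Finset.mul_sum] at h3
  linarith [hω N]

/-- The raising relation is divided by 1 - X ≥ δ. The factor 3 is 2 + 1, the 2 coming from 1/(j+1) ≤
2/(j+2) in the shifted sum. -/
theorem LogDominated.succ {ℓ : ℕ} {δ : ℝ} (hδ : 0 < δ) (hXδ : ∀ᵐ ω ∂μ, δ ≤ 1 - X ω)
    (h : LogDominated μ X ℓ) : LogDominated μ X (ℓ + 1) := by
  obtain ⟨w, hw, hle⟩ := h
  refine ⟨fun ω => 3 / δ * w ω, hw.const_mul _, ?_⟩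
  filter_upwards [hle, hXδ] with ω hω hωδ N
  have h1 : ∀ j : ℕ, |jacobi (ℓ + 1) (j + 1) (X ω)| / ((j : ℝ) + 1) ≤
      1 / δ * (2 * (|jacobi ℓ (j + 1 + 1) (X ω)| / (((j + 1 : ℕ) : ℝ) + 1)) +
        |jacobi ℓ (j + 1) (X ω)| / ((j : ℝ) + 1)) := by
    intro j
    have hj : (0 : ℝ) < (j : ℝ) + 1 := by positivity
    have hl : (0 : ℝ) ≤ ℓ := by positivity
    have e := one_sub_mul_jacobi ℓ (j + 1) (X ω)
    push_cast at e ⊢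
    have hA : 0 < 2 * ((j : ℝ) + 1) + ℓ + 1 := by positivity
    set F := |jacobi (ℓ + 1) (j + 1) (X ω)|
    set G := |jacobi ℓ (j + 1 + 1) (X ω)|
    set H := |jacobi ℓ (j + 1) (X ω)|
    have hF : 0 ≤ F := abs_nonneg _
    have hG : 0 ≤ G := abs_nonneg _
    have hH : 0 ≤ H := abs_nonneg _
    have e1 : (2 * ((j : ℝ) + 1) + ℓ + 1) * ((1 - X ω) * F) ≤
        (2 * ((j : ℝ) + 1) + ℓ + 1) * (G + H) := by
      have := congrArg abs e
      rw [abs_mul, abs_mul, abs_of_pos hA, abs_of_pos (hδ.trans_le hωδ)] at this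
      have h4 := abs_add_le (((j : ℝ) + 1 + 1) * jacobi ℓ (j + 1 + 1) (X ω))
        (((j : ℝ) + 1 + ℓ) * jacobi ℓ (j + 1) (X ω))
      rw [abs_mul, abs_mul, abs_of_pos (show (0 : ℝ) < (j : ℝ) + 1 + 1 by positivity),
        abs_of_pos (show (0 : ℝ) < (j : ℝ) + 1 + ℓ by positivity)] at h4
      have h5 : ((j : ℝ) + 1 + 1) * G ≤ (2 * ((j : ℝ) + 1) + ℓ + 1) * G :=
        mul_le_mul_of_nonneg_right (by linarith) hG
      have h6 : ((j : ℝ) + 1 + ℓ) * H ≤ (2 * ((j : ℝ) + 1) + ℓ + 1) * H :=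
        mul_le_mul_of_nonneg_right (by linarith) hH
      linarith
    have e2 : δ * F ≤ G + H :=
      (mul_le_mul_of_nonneg_right hωδ hF).trans (le_of_mul_le_mul_left e1 hA)
    have e3 : G / ((j : ℝ) + 1) ≤ 2 * (G / ((j : ℝ) + 1 + 1)) := by
      rw [← mul_div_assoc, div_le_div_iff₀ hj (by positivity)]
      nlinarith [mul_nonneg hG (show (0 : ℝ) ≤ j by positivity)]
    calc F / ((j : ℝ) + 1) ≤ (1 / δ * (G + H)) / ((j : ℝ) + 1) := by
          refine div_le_div_of_nonneg_right ?_ hj.le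
          rw [one_div_mul_eq_div, le_div_iff₀ hδ]
          linarith
      _ = 1 / δ * (G / ((j : ℝ) + 1) + H / ((j : ℝ) + 1)) := by ring
      _ ≤ _ := mul_le_mul_of_nonneg_left (by linarith) (by positivity)
  have h2 : ∑ j ∈ Finset.range N, |jacobi ℓ (j + 1 + 1) (X ω)| / (((j + 1 : ℕ) : ℝ) + 1) ≤ w ω := by
    refine le_trans ?_ (hω (N + 1))
    rw [Finset.sum_range_succ']
    exact le_add_of_nonneg_right (by positivity)
  refine (Finset.sum_le_sum fun j _ => h1 j).trans ?_
  rw [← Finset.mul_sum, Finset.sum_add_distrib, ← Finset.mul_sum,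
    show 3 / δ * w ω = 1 / δ * (2 * w ω + w ω) by ring]
  exact mul_le_mul_of_nonneg_left (by linarith [hω N]) (by positivity)

theorem hasSum_logTerm_zero [IsFiniteMeasure μ] (hX : AEMeasurable X μ)
    (h01 : ∀ᵐ ω ∂μ, X ω ∈ Set.Ioo (0 : ℝ) 1)
    (hlog : Integrable (fun ω => Real.log (X ω)) μ) (h : LogDominated μ X 0) :
    HasSum (logTerm μ X 0) (-∫ ω, Real.log (X ω) ∂μ) := by
  rw [(h.summable_logTerm hX h01).hasSum_iff_tendsto_nat]
  have hInt := fun j : ℕ => (integrable_jacobi hX h01 0 (j + 1)).const_mul (2 / ((j : ℝ) + 1))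
  have hrem : ∀ N : ℕ, ∫ ω, logRemainder N (X ω) ∂μ - ∫ ω, Real.log (X ω) ∂μ =
      ∑ j ∈ Finset.range N, logTerm μ X 0 j := by
    intro N
    unfold logRemainder
    rw [integral_add hlog (integrable_finsetSum _ fun j _ => hInt j),
      integral_finsetSum _ fun j _ => hInt j, add_sub_cancel_left]
    refine Finset.sum_congr rfl fun j _ => ?_
    have hj : (j : ℝ) + 1 ≠ 0 := by positivity
    rw [integral_const_mul, logTerm, jacobiMean]
    congr 1
    push_cast
    field_simp
    ring
  have hlim : Filter.Tendsto (fun N => ∫ ω, logRemainder N (X ω) ∂μ) Filter.atTop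
      (nhds (∫ _, (0 : ℝ) ∂μ)) := by
    refine tendsto_integral_of_dominated_convergence (fun ω => -Real.log (X ω)) ?_ hlog.neg ?_ ?_
    · exact fun N => (hlog.add (integrable_finsetSum _ fun j _ => hInt j)).aestronglyMeasurable
    · intro N
      filter_upwards [h01] with ω hω using abs_logRemainder_le N hω.1 hω.2.le
    · filter_upwards [h01] with ω hω using tendsto_logRemainder hω.1 hω.2.le
  simpa using (hlim.sub_const (∫ ω, Real.log (X ω) ∂μ)).congr hrem

/-- Contiguity splits a term at ℓ into E_{j+1}/(j+1) + E_j/(j+1+ℓ), with E_j the means at ℓ + 1.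
Regrouping by E_{j+1} gives the coefficient 1/(j+1) + 1/(j+2+ℓ) of the term at ℓ + 1. What remains
is E_0/(ℓ+1), with E_0 = 1, and the last boundary term. -/
theorem sum_logTerm_eq [IsProbabilityMeasure μ] (hX : AEMeasurable X μ)
    (h01 : ∀ᵐ ω ∂μ, X ω ∈ Set.Ioo (0 : ℝ) 1) (ℓ N : ℕ) :
    ∑ j ∈ Finset.range N, logTerm μ X ℓ j = 1 / ((ℓ : ℝ) + 1) +
      ∑ j ∈ Finset.range N, logTerm μ X (ℓ + 1) j -
        jacobiMean μ X (ℓ + 1) N / ((N : ℝ) + ℓ + 1) := by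
  induction N with
  | zero => simp [jacobiMean]
  | succ N ih =>
    rw [Finset.sum_range_succ, ih, Finset.sum_range_succ]
    have e := jacobiMean_contiguous hX h01 ℓ N
    unfold logTerm
    have hN : (N : ℝ) + 1 ≠ 0 := by positivity
    have hNl : (N : ℝ) + 1 + ℓ ≠ 0 := by positivity
    have hNl' : (N : ℝ) + ℓ + 1 ≠ 0 := by positivity
    have hNl2 : (N : ℝ) + 1 + (ℓ + 1) ≠ 0 := by positivity
    have hNl3 : (N : ℝ) + 1 + ℓ + 1 ≠ 0 := by positivity
    rw [div_mul_eq_mul_div, e]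
    push_cast
    field_simp
    ring

theorem LogDominated.tendsto_jacobiMean_div [IsFiniteMeasure μ] (hX : AEMeasurable X μ)
    (h01 : ∀ᵐ ω ∂μ, X ω ∈ Set.Ioo (0 : ℝ) 1) {ℓ : ℕ} (h : LogDominated μ X ℓ) {a : ℝ}
    (ha : 0 ≤ a) :
    Filter.Tendsto (fun N : ℕ => jacobiMean μ X ℓ N / ((N : ℝ) + a)) Filter.atTop (nhds 0) := by
  rw [← Filter.tendsto_add_atTop_iff_nat 1]
  refine squeeze_zero_norm (fun N => ?_) (h.summable_jacobiMean hX h01).tendsto_atTop_zero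
  push_cast
  rw [norm_div, Real.norm_eq_abs, Real.norm_of_nonneg (by positivity)]
  exact div_le_div_of_nonneg_left (abs_nonneg _) (by positivity) (by linarith)

theorem hasSum_logTerm_succ [IsProbabilityMeasure μ] (hX : AEMeasurable X μ)
    (h01 : ∀ᵐ ω ∂μ, X ω ∈ Set.Ioo (0 : ℝ) 1) {ℓ : ℕ} {S : ℝ}
    (hS : HasSum (logTerm μ X ℓ) S) (h : LogDominated μ X (ℓ + 1)) :
    HasSum (logTerm μ X (ℓ + 1)) (S - 1 / ((ℓ : ℝ) + 1)) := by
  rw [(h.summable_logTerm hX h01).hasSum_iff_tendsto_nat]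
  have h1 := (hS.tendsto_sum_nat.sub_const (1 / ((ℓ : ℝ) + 1))).add
    (h.tendsto_jacobiMean_div hX h01 (a := (ℓ : ℝ) + 1) (by positivity))
  rw [add_zero] at h1
  refine h1.congr fun N => ?_
  rw [sum_logTerm_eq hX h01, add_assoc]
  ring

theorem hasSum_logTerm [IsProbabilityMeasure μ] (hX : AEMeasurable X μ)
    (h01 : ∀ᵐ ω ∂μ, X ω ∈ Set.Ioo (0 : ℝ) 1)
    (hlog : Integrable (fun ω => Real.log (X ω)) μ) {ℓ : ℕ}
    (h : ∀ m ≤ ℓ, LogDominated μ X m) :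
    HasSum (logTerm μ X ℓ) (-(harmonic ℓ : ℝ) - ∫ ω, Real.log (X ω) ∂μ) := by
  induction ℓ with
  | zero => simpa using hasSum_logTerm_zero hX h01 hlog (h 0 le_rfl)
  | succ ℓ ih =>
    have h1 := hasSum_logTerm_succ hX h01 (ih fun m hm => h m (by omega)) (h _ le_rfl)
    convert h1 using 1
    rw [harmonic_succ]
    push_cast
    ring

end Expectation

/-! ### Integrability of the logarithm of a linear form on the torus -/

/-- The value of the linear form with coefficients `D` at the point of the torus with angles `θ`. -/
noncomputable def torusValue {N : ℕ} (D : Fin N → ℂ) (θ : Fin N → ℝ) : ℂ :=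
  ∑ i, D i * Complex.exp (θ i * Complex.I)

theorem logAbsOnTorus_linearForm {n : ℕ} (D : Fin (n + 1) → ℂ) (θ : Fin (n + 1) → ℝ) :
    logAbsOnTorus (linearForm D) θ = Real.log ‖torusValue D θ‖ := by
  simp [logAbsOnTorus, linearForm, torusValue]

theorem continuous_torusValue {N : ℕ} (D : Fin N → ℂ) : Continuous (torusValue D) := by
  unfold torusValue
  fun_prop

theorem norm_torusValue_le {N : ℕ} (D : Fin N → ℂ) (θ : Fin N → ℝ) :
    ‖torusValue D θ‖ ≤ ∑ i, ‖D i‖ := by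
  refine (norm_sum_le _ _).trans (Finset.sum_le_sum fun i _ => ?_)
  rw [norm_mul, Complex.norm_exp_ofReal_mul_I, mul_one]

theorem volume_restrict_angleCube (N : ℕ) :
    (volume : Measure (Fin N → ℝ)).restrict (angleCube N) =
      Measure.pi fun _ : Fin N => (volume : Measure ℝ).restrict (Set.Icc 0 (2 * Real.pi)) := by
  rw [← Measure.restrict_pi_pi, Set.pi_univ_Icc]
  rfl

/-- The zeros lie in a single coset of 2πℤ, hence are countable. -/
theorem ae_add_mul_exp_ne_zero (A : ℂ) {W : ℂ} (hW : W ≠ 0) :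
    ∀ᵐ s : ℝ, A + W * Complex.exp (s * Complex.I) ≠ 0 := by
  have hc : {s : ℝ | A + W * Complex.exp (s * Complex.I) = 0}.Countable := by
    rcases Set.eq_empty_or_nonempty {s : ℝ | A + W * Complex.exp (s * Complex.I) = 0}
      with h | ⟨t, ht⟩
    · rw [h]; exact Set.countable_empty
    · refine (Set.countable_range fun m : ℤ => t + m * (2 * Real.pi)).mono fun s hs => ?_
      have h1 : Complex.exp (s * Complex.I) = Complex.exp (t * Complex.I) :=
        mul_left_cancel₀ hW (add_left_cancel (hs.trans ht.symm))
      obtain ⟨m, hm⟩ := Complex.exp_eq_exp_iff_exists_int.1 h1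
      refine ⟨m, ?_⟩
      have h2 : (s : ℂ) * Complex.I = ((t + m * (2 * Real.pi) : ℝ) : ℂ) * Complex.I := by
        rw [hm]; push_cast; ring
      exact (Complex.ofReal_injective (mul_right_cancel₀ Complex.I_ne_zero h2)).symm
  filter_upwards [hc.ae_notMem volume] with s hs using hs

theorem log_norm_add_mul_exp_ae_eq (A : ℂ) {W : ℂ} (hW : W ≠ 0) :
    (fun s : ℝ => Real.log ‖A + W * Complex.exp (s * Complex.I)‖) =ᵐ[volume]
      fun s => Real.log ‖W‖ + Real.log ‖circleMap 0 1 s + A / W‖ := by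
  filter_upwards [ae_add_mul_exp_ne_zero A hW] with s hs
  have h : A + W * Complex.exp (s * Complex.I) = W * (circleMap 0 1 s + A / W) := by
    rw [circleMap_zero]
    field_simp
    push_cast
    ring
  rw [h] at hs
  rw [h, norm_mul, Real.log_mul (norm_ne_zero_iff.2 hW)
    (norm_ne_zero_iff.2 (right_ne_zero_of_mul hs))]

theorem intervalIntegrable_log_norm_circleMap_add (b : ℂ) :
    IntervalIntegrable (fun s => Real.log ‖circleMap 0 1 s + b‖) volume 0 (2 * Real.pi) := by
  have h := circleIntegrable_log_norm_sub_const (a := -b) (c := 0) 1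
  simp only [sub_neg_eq_add] at h
  exact h

theorem intervalIntegrable_log_norm_add_mul_exp (A : ℂ) {W : ℂ} (hW : W ≠ 0) :
    IntervalIntegrable (fun s : ℝ => Real.log ‖A + W * Complex.exp (s * Complex.I)‖) volume
      0 (2 * Real.pi) :=
  (intervalIntegrable_const.add (intervalIntegrable_log_norm_circleMap_add (A / W))).congr_ae
    (ae_restrict_of_ae (log_norm_add_mul_exp_ae_eq A hW).symm)

/-- A consequence of Jensen's formula for a linear polynomial. -/
theorem two_pi_mul_log_norm_le_integral (A : ℂ) {W : ℂ} (hW : W ≠ 0) :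
    2 * Real.pi * Real.log ‖W‖ ≤
      ∫ s in (0 : ℝ)..2 * Real.pi, Real.log ‖A + W * Complex.exp (s * Complex.I)‖ := by
  rw [intervalIntegral.integral_congr_ae
    ((log_norm_add_mul_exp_ae_eq A hW).mono fun s hs _ => hs),
    intervalIntegral.integral_add intervalIntegrable_const
      (intervalIntegrable_log_norm_circleMap_add (A / W)), intervalIntegral.integral_const,
    sub_zero, smul_eq_mul]
  refine le_add_of_nonneg_right ?_
  -- The circle average of log |z + A/W| is log⁺ |A/W|, which is nonnegative.
  have h := circleAverage_log_norm_add_const_eq_posLog (a := A / W)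
  rw [Real.circleAverage_def, smul_eq_mul, inv_mul_eq_div, div_eq_iff Real.two_pi_pos.ne'] at h
  rw [h]
  exact mul_nonneg Real.posLog_nonneg Real.two_pi_pos.le

theorem integral_abs_log_norm_add_mul_exp_le (A : ℂ) {W : ℂ} (hW : W ≠ 0) {B : ℝ} (hB : 0 ≤ B)
    (hle : ∀ s : ℝ, Real.log ‖A + W * Complex.exp (s * Complex.I)‖ ≤ B) :
    ∫ s in (0 : ℝ)..2 * Real.pi, |Real.log ‖A + W * Complex.exp (s * Complex.I)‖| ≤
      2 * Real.pi * (2 * B - Real.log ‖W‖) := by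
  have hInt := intervalIntegrable_log_norm_add_mul_exp A hW
  calc _ ≤ ∫ s in (0 : ℝ)..2 * Real.pi,
        (2 * B - Real.log ‖A + W * Complex.exp (s * Complex.I)‖) := by
        -- If L ≤ B and B ≥ 0, then |L| ≤ 2B - L.
        refine intervalIntegral.integral_mono_on Real.two_pi_pos.le hInt.abs
          (intervalIntegrable_const.sub hInt) fun s _ => ?_
        rw [abs_le]
        constructor <;> linarith [hle s]
    _ = 2 * Real.pi * (2 * B) -
        ∫ s in (0 : ℝ)..2 * Real.pi, Real.log ‖A + W * Complex.exp (s * Complex.I)‖ := by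
        rw [intervalIntegral.integral_sub intervalIntegrable_const hInt,
          intervalIntegral.integral_const, sub_zero, smul_eq_mul]
    _ ≤ _ := by linarith [two_pi_mul_log_norm_le_integral A hW]

theorem torusValue_eq_add {n : ℕ} (D : Fin (n + 1) → ℂ) (i : Fin (n + 1)) (θ : Fin (n + 1) → ℝ) :
    torusValue D θ = torusValue (fun k => D (i.succAbove k)) (fun k => θ (i.succAbove k)) +
      D i * Complex.exp (θ i * Complex.I) := by
  rw [torusValue, Fin.sum_univ_succAbove _ i, add_comm]
  rfl

theorem ae_torusValue_ne_zero {n : ℕ} {D : Fin (n + 1) → ℂ} (hD : D ≠ 0) :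
    ∀ᵐ θ ∂(volume.restrict (angleCube (n + 1))), torusValue D θ ≠ 0 := by
  obtain ⟨i, hi : D i ≠ 0⟩ := Function.ne_iff.1 hD
  refine ae_restrict_of_ae ?_
  have mp := volume_preserving_piFinSuccAbove (fun _ : Fin (n + 1) => ℝ) i
  have hm : MeasurableSet {z : ℝ × (Fin n → ℝ) | torusValue (fun k => D (i.succAbove k)) z.2 +
      D i * Complex.exp (z.1 * Complex.I) ≠ 0} := by
    have h : Continuous fun z : ℝ × (Fin n → ℝ) => torusValue (fun k => D (i.succAbove k)) z.2 +
        D i * Complex.exp (z.1 * Complex.I) :=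
      ((continuous_torusValue _).comp continuous_snd).add (by fun_prop)
    exact (isOpen_ne_fun h continuous_const).measurableSet
  have h : ∀ᵐ z : ℝ × (Fin n → ℝ), torusValue (fun k => D (i.succAbove k)) z.2 +
      D i * Complex.exp (z.1 * Complex.I) ≠ 0 := by
    rw [Measure.volume_eq_prod, Measure.ae_prod_iff_ae_ae hm, Measure.ae_ae_comm hm]
    exact Filter.Eventually.of_forall fun y =>
      ae_add_mul_exp_ne_zero (torusValue (fun k => D (i.succAbove k)) y) hi
  filter_upwards [mp.quasiMeasurePreserving.ae h] with θ hθ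
  rw [torusValue_eq_add D i]
  exact hθ

/-- Fubini in a coordinate with nonzero coefficient: Jensen's formula bounds the inner integral of
|log| uniformly in the other angles. -/
theorem integrableOn_log_norm_torusValue {n : ℕ} {D : Fin (n + 1) → ℂ} (hD : D ≠ 0) :
    IntegrableOn (fun θ => Real.log ‖torusValue D θ‖) (angleCube (n + 1)) := by
  obtain ⟨i, hi : D i ≠ 0⟩ := Function.ne_iff.1 hD
  set V : Measure ℝ := (volume : Measure ℝ).restrict (Set.Icc 0 (2 * Real.pi)) with hV
  -- The added 1 makes B nonnegative, so the bound also covers zeros of the form, where `Real.log 0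
  -- = 0`.
  set B : ℝ := Real.log (1 + ∑ k, ‖D k‖)
  have hs : 0 ≤ ∑ k, ‖D k‖ := Finset.sum_nonneg fun k _ => norm_nonneg _
  have hB : 0 ≤ B := Real.log_nonneg (by linarith)
  have hle : ∀ θ, Real.log ‖torusValue D θ‖ ≤ B := fun θ => by
    rcases eq_or_ne (torusValue D θ) 0 with h | h
    · simpa [h] using hB
    · exact Real.log_le_log (norm_pos_iff.2 h) (by linarith [norm_torusValue_le D θ])
  set g : ℝ × (Fin n → ℝ) → ℝ := fun z => Real.log ‖torusValue (fun k => D (i.succAbove k)) z.2 +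
    D i * Complex.exp (z.1 * Complex.I)‖ with hg
  have hgle : ∀ s y, g (s, y) ≤ B := fun s y => by
    have := hle (i.insertNth s y)
    rw [torusValue_eq_add D i] at this
    simpa [hg] using this
  have hgm : Measurable g := by
    refine Real.measurable_log.comp (Continuous.measurable ?_)
    exact (((continuous_torusValue _).comp continuous_snd).add (by fun_prop)).norm
  have hgint : Integrable g (V.prod (Measure.pi fun _ : Fin n => V)) := by
    rw [integrable_prod_iff' hgm.aestronglyMeasurable]
    constructor
    · refine Filter.Eventually.of_forall fun y => ?_
      have := intervalIntegrable_log_norm_add_mul_exp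
        (torusValue (fun k => D (i.succAbove k)) y) hi
      rw [intervalIntegrable_iff_integrableOn_Icc_of_le Real.two_pi_pos.le] at this
      exact this
    · have hm : StronglyMeasurable fun y => ∫ s, ‖g (s, y)‖ ∂V :=
        StronglyMeasurable.integral_prod_left' (f := fun z => ‖g z‖) hgm.norm.stronglyMeasurable
      refine Integrable.of_bound hm.aestronglyMeasurable
        (2 * Real.pi * (2 * B - Real.log ‖D i‖)) (Filter.Eventually.of_forall fun y => ?_)
      have h0 : 0 ≤ ∫ s, ‖g (s, y)‖ ∂V := integral_nonneg fun s => norm_nonneg (g (s, y))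
      have h1 : ∫ s, ‖g (s, y)‖ ∂V = ∫ s in (0 : ℝ)..2 * Real.pi, ‖g (s, y)‖ := by
        rw [intervalIntegral.integral_of_le Real.two_pi_pos.le, ← integral_Icc_eq_integral_Ioc]
      rw [Real.norm_of_nonneg h0, h1]
      exact integral_abs_log_norm_add_mul_exp_le
        (torusValue (fun k => D (i.succAbove k)) y) hi hB fun s => hgle s y
  have mp := measurePreserving_piFinSuccAbove (fun _ : Fin (n + 1) => V) i
  rw [IntegrableOn, volume_restrict_angleCube]
  have h := (mp.integrable_comp_emb
    (MeasurableEquiv.piFinSuccAbove (fun _ : Fin (n + 1) => ℝ) i).measurableEmbedding).2 hgint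
  refine h.congr (Filter.Eventually.of_forall fun θ => ?_)
  simp only [Function.comp_apply, hg]
  rw [torusValue_eq_add D i]
  rfl

/-! ### Even moments of the linear form -/

theorem torusValue_pow {N : ℕ} (D : Fin N → ℂ) (θ : Fin N → ℝ) (k : ℕ) :
    torusValue D θ ^ k = ∑ e ∈ Finset.piAntidiag Finset.univ k,
      (Nat.multinomial Finset.univ e : ℂ) *
        ∏ i, (D i ^ e i * Complex.exp (θ i * Complex.I) ^ e i) := by
  rw [torusValue, Finset.sum_pow_eq_sum_piAntidiag]
  simp_rw [mul_pow]

theorem star_torusValue_pow {N : ℕ} (D : Fin N → ℂ) (θ : Fin N → ℝ) (k : ℕ) :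
    starRingEnd ℂ (torusValue D θ) ^ k = ∑ e ∈ Finset.piAntidiag Finset.univ k,
      (Nat.multinomial Finset.univ e : ℂ) *
        ∏ i, (starRingEnd ℂ (D i) ^ e i * Complex.exp (-(θ i * Complex.I)) ^ e i) := by
  rw [← map_pow, torusValue_pow, map_sum]
  refine Finset.sum_congr rfl fun e _ => ?_
  simp [map_prod, ← Complex.exp_conj]

/-- Parseval for the k-th power of the form: only equal exponent vectors survive integration. -/
theorem integral_norm_torusValue_pow {n : ℕ} (D : Fin (n + 1) → ℂ) (k : ℕ) :
    ∫ θ in angleCube (n + 1), ‖torusValue D θ‖ ^ (2 * k) =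
      (2 * Real.pi) ^ (n + 1) * a k D := by
  have hexp : ∀ θ : Fin (n + 1) → ℝ, ((‖torusValue D θ‖ ^ (2 * k) : ℝ) : ℂ) =
      ∑ e ∈ Finset.piAntidiag (Finset.univ : Finset (Fin (n + 1))) k,
        ∑ f ∈ Finset.piAntidiag (Finset.univ : Finset (Fin (n + 1))) k,
        ((Nat.multinomial Finset.univ e : ℂ) * Nat.multinomial Finset.univ f) *
          ∏ i, (D i ^ e i * starRingEnd ℂ (D i) ^ f i *
            (Complex.exp (θ i * Complex.I) ^ e i * Complex.exp (-(θ i * Complex.I)) ^ f i)) := by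
    intro θ
    push_cast
    rw [pow_mul, ← Complex.mul_conj', mul_pow, torusValue_pow, star_torusValue_pow,
      Finset.sum_mul_sum]
    refine Finset.sum_congr rfl fun e _ => Finset.sum_congr rfl fun f _ => ?_
    rw [mul_mul_mul_comm, ← Finset.prod_mul_distrib]
    congr 1
    refine Finset.prod_congr rfl fun i _ => ?_
    ring
  have hcube : ∀ F : (Fin (n + 1) → ℝ) → ℂ, Continuous F →
      Integrable F (volume.restrict (angleCube (n + 1))) := fun F hF => hF.integrableOn_Icc
  have hone : ∀ (u : ℂ) (p q : ℕ), ∫ s in Set.Icc (0 : ℝ) (2 * Real.pi),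
      u * (Complex.exp (s * Complex.I) ^ p * Complex.exp (-(s * Complex.I)) ^ q) =
        if p = q then u * ((2 * Real.pi : ℝ) : ℂ) else 0 := by
    intro u p q
    rw [integral_Icc_eq_integral_Ioc, ← intervalIntegral.integral_of_le Real.two_pi_pos.le,
      intervalIntegral.integral_const_mul, integral_exp_pow_mul_exp_neg_pow, mul_ite, mul_zero]
  apply Complex.ofReal_injective
  rw [← integral_complex_ofReal]
  simp_rw [hexp]
  rw [integral_finsetSum _ fun e _ => hcube _ (by fun_prop)]
  rw [a]
  push_cast
  rw [Finset.mul_sum]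
  refine Finset.sum_congr rfl fun e he => ?_
  rw [integral_finsetSum _ fun f _ => hcube _ (by fun_prop)]
  simp_rw [integral_const_mul]
  have hprod : ∀ f : Fin (n + 1) → ℕ, ∫ θ in angleCube (n + 1),
      ∏ i, (D i ^ e i * starRingEnd ℂ (D i) ^ f i *
        (Complex.exp (θ i * Complex.I) ^ e i * Complex.exp (-(θ i * Complex.I)) ^ f i)) =
      if e = f then ∏ i, (D i ^ e i * starRingEnd ℂ (D i) ^ f i * ((2 * Real.pi : ℝ) : ℂ))
        else 0 := by
    intro f
    rw [volume_restrict_angleCube, integral_fintype_prod_eq_prod (fun i (s : ℝ) =>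
      D i ^ e i * starRingEnd ℂ (D i) ^ f i *
        (Complex.exp (s * Complex.I) ^ e i * Complex.exp (-(s * Complex.I)) ^ f i))]
    simp_rw [hone, Finset.prod_ite_zero, funext_iff]
    simp
  simp_rw [hprod, mul_ite, mul_zero]
  rw [Finset.sum_ite_eq, if_pos he, Finset.prod_mul_distrib, Finset.prod_const, Finset.card_univ,
    Fintype.card_fin]
  have hD : ∀ i, D i ^ e i * starRingEnd ℂ (D i) ^ e i = (‖D i‖ : ℂ) ^ (2 * e i) := fun i => by
    rw [← mul_pow, Complex.mul_conj', pow_mul]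
  simp_rw [hD]
  push_cast
  ring

/-! ### A sharpened Cauchy-Schwarz inequality -/

/-- Lagrange's identity writes the Cauchy-Schwarz defect as half the double sum of (x_k - x_m)²; the
pairs (i, j) and (j, i) are retained. -/
theorem sum_sq_add_sub_sq_le {n : ℕ} (x : Fin (n + 1) → ℝ) {i j : Fin (n + 1)} (hij : i ≠ j) :
    (∑ k, x k) ^ 2 + (x i - x j) ^ 2 ≤ ((n : ℝ) + 1) * ∑ k, x k ^ 2 := by
  have h1 : ∑ k, ∑ m, (x k - x m) ^ 2 =
      2 * (((n : ℝ) + 1) * ∑ k, x k ^ 2) - 2 * (∑ k, x k) ^ 2 := by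
    simp_rw [sub_sq, Finset.sum_add_distrib, Finset.sum_sub_distrib, mul_assoc, ← Finset.mul_sum,
      ← Finset.sum_mul]
    simp only [Finset.sum_const, Finset.card_univ, Fintype.card_fin, nsmul_eq_mul]
    rw [← Finset.mul_sum]
    push_cast
    ring
  have h2 := Finset.add_le_sum (s := Finset.univ) (f := fun k => ∑ m, (x k - x m) ^ 2)
    (fun k _ => Finset.sum_nonneg fun m _ => sq_nonneg _) (Finset.mem_univ i) (Finset.mem_univ j)
    hij
  have h3 : ∀ k m, (x k - x m) ^ 2 ≤ ∑ m, (x k - x m) ^ 2 := fun k m =>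
    Finset.single_le_sum (f := fun m => (x k - x m) ^ 2) (fun m _ => sq_nonneg _)
      (Finset.mem_univ m)
  have h4 := h3 i j
  have h5 := h3 j i
  have h6 : (x j - x i) ^ 2 = (x i - x j) ^ 2 := by ring
  linarith

/-- A sharpening of the Cauchy-Schwarz inequality. -/
theorem norm_sum_sq_add_norm_sub_sq_le {n : ℕ} (w : Fin (n + 1) → ℂ) {i j : Fin (n + 1)}
    (hij : i ≠ j) :
    ‖∑ k, w k‖ ^ 2 + ‖w i - w j‖ ^ 2 ≤ ((n : ℝ) + 1) * ∑ k, ‖w k‖ ^ 2 := by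
  have hr := sum_sq_add_sub_sq_le (fun k => (w k).re) hij
  have hi := sum_sq_add_sub_sq_le (fun k => (w k).im) hij
  simp only [Complex.sq_norm, Complex.normSq_apply, Complex.re_sum, Complex.im_sum,
    Complex.sub_re, Complex.sub_im, Finset.sum_add_distrib, mul_add]
  simp only [sq] at hr hi
  linarith

theorem norm_torusValue_sq_add_le {n : ℕ} (D : Fin (n + 1) → ℂ) {i j : Fin (n + 1)} (hij : i ≠ j)
    (θ : Fin (n + 1) → ℝ) :
    ‖torusValue D θ‖ ^ 2 +
      ‖D i * Complex.exp (θ i * Complex.I) - D j * Complex.exp (θ j * Complex.I)‖ ^ 2 ≤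
        c D ^ 2 := by
  have h := norm_sum_sq_add_norm_sub_sq_le (fun k => D k * Complex.exp (θ k * Complex.I)) hij
  simp only [norm_mul, Complex.norm_exp_ofReal_mul_I, mul_one] at h
  rw [c, Real.sq_sqrt (by positivity)]
  exact h

theorem c_pos {n : ℕ} {D : Fin (n + 1) → ℂ} (hD : D ≠ 0) : 0 < c D := by
  obtain ⟨i, hi : D i ≠ 0⟩ := Function.ne_iff.1 hD
  refine Real.sqrt_pos.2 (mul_pos (by positivity) ?_)
  exact Finset.sum_pos' (fun k _ => by positivity)
    ⟨i, Finset.mem_univ i, pow_pos (norm_pos_iff.2 hi) 2⟩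

/-! ### The normalized squared modulus as a random variable -/

/-- The uniform probability measure on the cube of angles. -/
noncomputable def angleMeasure (N : ℕ) : Measure (Fin N → ℝ) :=
  (ENNReal.ofReal ((2 * Real.pi) ^ N))⁻¹ • volume.restrict (angleCube N)

theorem integral_angleMeasure (N : ℕ) (f : (Fin N → ℝ) → ℝ) :
    ∫ θ, f θ ∂(angleMeasure N) = 1 / (2 * Real.pi) ^ N * ∫ θ in angleCube N, f θ := by
  have h : (0 : ℝ) < (2 * Real.pi) ^ N := pow_pos Real.two_pi_pos N
  rw [angleMeasure, integral_smul_measure, ENNReal.toReal_inv, ENNReal.toReal_ofReal h.le,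
    smul_eq_mul, one_div]

instance isProbabilityMeasure_angleMeasure (N : ℕ) : IsProbabilityMeasure (angleMeasure N) := by
  have h : (0 : ℝ) < (2 * Real.pi) ^ N := pow_pos Real.two_pi_pos N
  constructor
  have hv : volume (angleCube N) = ENNReal.ofReal ((2 * Real.pi) ^ N) := by
    rw [angleCube, Real.volume_Icc_pi]
    simp [ENNReal.ofReal_pow Real.two_pi_pos.le]
  rw [angleMeasure, Measure.smul_apply, Measure.restrict_apply_univ, hv, smul_eq_mul]
  exact ENNReal.inv_mul_cancel (by simpa using h) ENNReal.ofReal_ne_top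

theorem integrable_angleMeasure {N : ℕ} {f : (Fin N → ℝ) → ℝ}
    (hf : IntegrableOn f (angleCube N)) : Integrable f (angleMeasure N) := by
  refine hf.smul_measure (ENNReal.inv_ne_top.2 ?_)
  simpa using pow_pos Real.two_pi_pos N

theorem ae_angleMeasure {N : ℕ} {p : (Fin N → ℝ) → Prop}
    (h : ∀ᵐ θ ∂(volume.restrict (angleCube N)), p θ) : ∀ᵐ θ ∂(angleMeasure N), p θ :=
  Measure.smul_absolutelyContinuous.ae_le h

/-- The squared modulus of the linear form on the torus, divided by `c D ^ 2`. -/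
noncomputable def normalizedSq {n : ℕ} (D : Fin (n + 1) → ℂ) (θ : Fin (n + 1) → ℝ) : ℝ :=
  ‖torusValue D θ‖ ^ 2 / c D ^ 2

variable {n : ℕ} {D : Fin (n + 1) → ℂ}

theorem measurable_normalizedSq (D : Fin (n + 1) → ℂ) : Measurable (normalizedSq D) :=
  (((continuous_torusValue D).norm.pow 2).div_const _).measurable

theorem integral_normalizedSq_pow (D : Fin (n + 1) → ℂ) (k : ℕ) :
    ∫ θ, normalizedSq D θ ^ k ∂(angleMeasure (n + 1)) = a k D / c D ^ (2 * k) := by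
  have h : (2 * Real.pi) ^ (n + 1) ≠ 0 := (pow_pos Real.two_pi_pos _).ne'
  simp_rw [normalizedSq, div_pow, ← pow_mul]
  rw [integral_div, integral_angleMeasure, integral_norm_torusValue_pow, ← mul_assoc,
    one_div_mul_cancel h, one_mul]

/-- The coefficients of the difference of the `i`-th and `j`-th monomials of the form. -/
def pairDifference (D : Fin (n + 1) → ℂ) (i j : Fin (n + 1)) : Fin (n + 1) → ℂ :=
  Pi.single i (D i) - Pi.single j (D j)

theorem torusValue_pairDifference (D : Fin (n + 1) → ℂ) (i j : Fin (n + 1))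
    (θ : Fin (n + 1) → ℝ) :
    torusValue (pairDifference D i j) θ =
      D i * Complex.exp (θ i * Complex.I) - D j * Complex.exp (θ j * Complex.I) := by
  simp [torusValue, pairDifference, sub_mul, Finset.sum_sub_distrib, Pi.single_apply]

theorem pairDifference_ne_zero {i j : Fin (n + 1)} (hi : D i ≠ 0) (hij : i ≠ j) :
    pairDifference D i j ≠ 0 := by
  intro h
  have := congrFun h i
  simp [pairDifference, hij, hi] at this

/-- The lower bound is again the squared modulus of a linear form, so the results on zeros and on
integrability of log apply to 1 - X as well. -/
theorem norm_pairDifference_sq_div_le (hD : D ≠ 0) {i j : Fin (n + 1)} (hij : i ≠ j)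
    (θ : Fin (n + 1) → ℝ) :
    ‖torusValue (pairDifference D i j) θ‖ ^ 2 / c D ^ 2 ≤ 1 - normalizedSq D θ := by
  have hc : 0 < c D ^ 2 := pow_pos (c_pos hD) 2
  have h := norm_torusValue_sq_add_le D hij θ
  rw [normalizedSq, le_sub_iff_add_le, ← add_div, div_le_one hc, torusValue_pairDifference]
  linarith

theorem log_norm_sq_div {z : ℂ} (hz : z ≠ 0) {r : ℝ} (hr : 0 < r) :
    Real.log (‖z‖ ^ 2 / r ^ 2) = 2 * Real.log ‖z‖ - 2 * Real.log r := by
  have := norm_pos_iff.2 hz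
  rw [Real.log_div (by positivity) (by positivity), Real.log_pow, Real.log_pow]
  push_cast
  ring

theorem integrable_log_norm_torusValue (hD : D ≠ 0) :
    Integrable (fun θ => Real.log ‖torusValue D θ‖) (angleMeasure (n + 1)) :=
  integrable_angleMeasure (integrableOn_log_norm_torusValue hD)

theorem log_normalizedSq_ae_eq (hD : D ≠ 0) :
    (fun θ => Real.log (normalizedSq D θ)) =ᵐ[angleMeasure (n + 1)]
      fun θ => 2 * Real.log ‖torusValue D θ‖ - 2 * Real.log (c D) := by
  filter_upwards [ae_angleMeasure (ae_torusValue_ne_zero hD)] with θ hθ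
  exact log_norm_sq_div hθ (c_pos hD)

theorem integrable_log_normalizedSq (hD : D ≠ 0) :
    Integrable (fun θ => Real.log (normalizedSq D θ)) (angleMeasure (n + 1)) :=
  (((integrable_log_norm_torusValue hD).const_mul 2).sub (integrable_const _)).congr
    (log_normalizedSq_ae_eq hD).symm

theorem logMahlerMeasure_linearForm (hD : D ≠ 0) :
    logMahlerMeasure (linearForm D) = Real.log (c D) +
      1 / 2 * ∫ θ, Real.log (normalizedSq D θ) ∂(angleMeasure (n + 1)) := by
  rw [logMahlerMeasure, mahlerMeasure, Real.log_exp, ← integral_angleMeasure,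
    integral_congr_ae (log_normalizedSq_ae_eq hD),
    integral_sub ((integrable_log_norm_torusValue hD).const_mul 2) (integrable_const _),
    integral_const_mul, integral_const]
  simp_rw [logAbsOnTorus_linearForm]
  simp
  ring

theorem ae_normalizedSq_mem_Ioo (hn : 1 ≤ n) (hD : D ≠ 0) :
    ∀ᵐ θ ∂(angleMeasure (n + 1)), normalizedSq D θ ∈ Set.Ioo (0 : ℝ) 1 := by
  obtain ⟨i, hi : D i ≠ 0⟩ := Function.ne_iff.1 hD
  have : Nontrivial (Fin (n + 1)) := Fin.nontrivial_iff_two_le.2 (by omega)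
  obtain ⟨j, hji⟩ := exists_ne i
  filter_upwards [ae_angleMeasure (ae_torusValue_ne_zero hD),
    ae_angleMeasure (ae_torusValue_ne_zero (pairDifference_ne_zero hi hji.symm))] with θ h1 h2
  have hc := c_pos hD
  have h3 := norm_pairDifference_sq_div_le hD hji.symm θ
  have h4 := norm_pos_iff.2 h1
  have h5 := norm_pos_iff.2 h2
  have h6 : 0 < ‖torusValue (pairDifference D i j) θ‖ ^ 2 / c D ^ 2 := by positivity
  exact ⟨by unfold normalizedSq; positivity, by linarith⟩

theorem integrable_log_one_sub_normalizedSq (hn : 1 ≤ n) (hD : D ≠ 0) :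
    Integrable (fun θ => Real.log (1 - normalizedSq D θ)) (angleMeasure (n + 1)) := by
  obtain ⟨i, hi : D i ≠ 0⟩ := Function.ne_iff.1 hD
  have : Nontrivial (Fin (n + 1)) := Fin.nontrivial_iff_two_le.2 (by omega)
  obtain ⟨j, hji⟩ := exists_ne i
  have hne := pairDifference_ne_zero hi hji.symm
  have hc := c_pos hD
  refine Integrable.mono'
    ((integrable_const (2 * Real.log (c D))).sub
      ((integrable_log_norm_torusValue hne).const_mul 2))
    (Real.measurable_log.comp (measurable_const.sub (measurable_normalizedSq D))).aestronglyMeasurable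
    ?_
  filter_upwards [ae_normalizedSq_mem_Ioo hn hD, ae_angleMeasure (ae_torusValue_ne_zero hne)]
    with θ h1 h2
  have h3 := norm_pairDifference_sq_div_le hD hji.symm θ
  have h5 := norm_pos_iff.2 h2
  have h4 := Real.log_le_log (by positivity) h3
  rw [log_norm_sq_div h2 hc] at h4
  rw [Real.norm_of_nonpos (Real.log_nonpos (sub_nonneg.2 h1.2.le) (by linarith [h1.1]))]
  simp only [Pi.sub_apply]
  linarith

/-- If the moduli of the coefficients are not all equal, the normalized form stays away from `1`. -/
theorem exists_pos_le_one_sub_normalizedSq (hD : D ≠ 0) {i j : Fin (n + 1)}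
    (hij : ‖D i‖ ≠ ‖D j‖) : ∃ δ > 0, ∀ θ, δ ≤ 1 - normalizedSq D θ := by
  have hc := c_pos hD
  have h0 : 0 < |‖D i‖ - ‖D j‖| := abs_pos.2 (sub_ne_zero.2 hij)
  refine ⟨|‖D i‖ - ‖D j‖| ^ 2 / c D ^ 2, by positivity, fun θ => ?_⟩
  refine le_trans ?_ (norm_pairDifference_sq_div_le hD (ne_of_apply_ne (fun k => ‖D k‖) hij) θ)
  refine div_le_div_of_nonneg_right (pow_le_pow_left₀ h0.le ?_ 2) (by positivity)
  -- The reverse triangle inequality removes the dependence on the angles.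
  have := abs_norm_sub_norm_le (D i * Complex.exp (θ i * Complex.I))
    (D j * Complex.exp (θ j * Complex.I))
  rwa [norm_mul, norm_mul, Complex.norm_exp_ofReal_mul_I, Complex.norm_exp_ofReal_mul_I, mul_one,
    mul_one, ← torusValue_pairDifference] at this

theorem term_succ_eq_logTerm (hn : 1 ≤ n) (hD : D ≠ 0) (ℓ j : ℕ) :
    term D ℓ (j + 1) = logTerm (angleMeasure (n + 1)) (normalizedSq D) ℓ j := by
  rw [term, logTerm, jacobiMean_eq_sum (measurable_normalizedSq D).aemeasurable
    (ae_normalizedSq_mem_Ioo hn hD)]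
  simp_rw [integral_normalizedSq_pow, mul_div_assoc]
  push_cast
  rfl

theorem summable_term_and_logMahlerMeasure_eq (hn : 1 ≤ n) (hD : D ≠ 0) {ℓ : ℕ}
    (h : ∀ m ≤ ℓ, LogDominated (angleMeasure (n + 1)) (normalizedSq D) m) :
    Summable (fun j : ℕ => term D ℓ (j + 1)) ∧
      logMahlerMeasure (linearForm D) =
        Real.log (c D) - 1 / 2 * (harmonic ℓ : ℝ) - 1 / 2 * S D ℓ := by
  have hsum := hasSum_logTerm (measurable_normalizedSq D).aemeasurable
    (ae_normalizedSq_mem_Ioo hn hD) (integrable_log_normalizedSq hD) h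
  simp_rw [← funext (term_succ_eq_logTerm hn hD ℓ)] at hsum
  refine ⟨hsum.summable, ?_⟩
  rw [S, hsum.tsum_eq, logMahlerMeasure_linearForm hD]
  ring

end LinearMahler

theorem theorem1p2 (n : ℕ) (hn : 3 ≤ n) (D : Fin (n + 1) → ℂ) (hD : D ≠ 0) :
    IntegrableOn (LinearMahler.logAbsOnTorus (LinearMahler.linearForm D))
      (LinearMahler.angleCube (n + 1)) volume ∧
    (Summable (fun j : ℕ => LinearMahler.term D 1 (j + 1)) ∧
      LinearMahler.logMahlerMeasure (LinearMahler.linearForm D) =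
        Real.log (LinearMahler.c D) - 1 / 2 * (harmonic 1 : ℝ) - 1 / 2 * LinearMahler.S D 1) ∧
    (∀ ℓ : ℕ, 2 ≤ ℓ → (∃ i j : Fin (n + 1), ‖D i‖ ≠ ‖D j‖) →
      Summable (fun j : ℕ => LinearMahler.term D ℓ (j + 1)) ∧
      LinearMahler.logMahlerMeasure (LinearMahler.linearForm D) =
        Real.log (LinearMahler.c D) - 1 / 2 * (harmonic ℓ : ℝ) - 1 / 2 * LinearMahler.S D ℓ) ∧
    (Summable (fun j : ℕ => LinearMahler.term D 0 (j + 1)) ∧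
      LinearMahler.logMahlerMeasure (LinearMahler.linearForm D) =
        Real.log (LinearMahler.c D) - 1 / 2 * LinearMahler.S D 0) := by
  have hn1 : 1 ≤ n := by omega
  have h1 := LinearMahler.logDominated_one (LinearMahler.ae_normalizedSq_mem_Ioo hn1 hD)
    (LinearMahler.integrable_log_normalizedSq hD)
    (LinearMahler.integrable_log_one_sub_normalizedSq hn1 hD)
  have h0 := h1.zero
  refine ⟨?_, ?_, ?_, ?_⟩
  · simpa only [funext (LinearMahler.logAbsOnTorus_linearForm D)] using
      LinearMahler.integrableOn_log_norm_torusValue hD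
  · refine LinearMahler.summable_term_and_logMahlerMeasure_eq hn1 hD fun m hm => ?_
    interval_cases m
    exacts [h0, h1]
  · rintro ℓ - ⟨i, j, hij⟩
    obtain ⟨δ, hδ, hle⟩ := LinearMahler.exists_pos_le_one_sub_normalizedSq hD hij
    refine LinearMahler.summable_term_and_logMahlerMeasure_eq hn1 hD fun m _ => ?_
    -- The uniform gap δ lets domination climb from parameter 0 to every m.
    induction m with
    | zero => exact h0
    | succ m ih => exact (ih (by omega)).succ hδ (Filter.Eventually.of_forall hle)
  · have h := LinearMahler.summable_term_and_logMahlerMeasure_eq hn1 hD (ℓ := 0) fun m hm => by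
      rwa [Nat.le_zero.1 hm]
    simpa using h
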